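/- For integers $m\ge 0$ and $s$, let $\mathrm{ex}(m,K_s)$ denote the maximum number of edges of a simple graph on $m$ vertices containing no complete graph $K_s$. A graph is $\{K_r,\mathcal C_{\ge k}\}$-free if it contains neither $K_r$ nor a cycle of length at least $k$ as a subgraph. Write $e(G)$ for the number of edges of $G$. Let $n\ge k\ge 5$, let $t=\lfloor (k-1)/2\rfloor$, and let $r\le t+1$ be a positive integer (for $r\le 2$ no graph satisfies the hypotheses). Let $G$ be a $2$-connected $\{K_r,\mathcal C_{\ge k}\}$-free simple graph with $n$ vertices, and let $C$ be a longest cycle in $G$. (1) If $|V(C)|=k-1$ and there is a vertex $u\in V(G)\setminus V(C)$ with exactly $t$ neighbours on $C$, then $$e(G)\le \mathrm{ex}(t,K_{r-1})+t(n-t).$$ (2) If $k$ is even, $|V(C)|=k-2$, and there is a vertex $u\in V(G)\setminus V(C)$ with exactly $t$ neighbours on $C$, then $$e(G)\le \mathrm{ex}(t,K_{r-1})+t(n-t).$$ (3) If neither the hypothesis of (1) nor that of (2) holds, then $$e(G)\le \max\left\{\left(t-\tfrac12\right)(n-1),\ \mathrm{ex}(k-1,K_r)+\left(t-\tfrac12\right)(n-k+1)\right\}.$$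 -/

import Mathlib

namespace CliqueCircumference

/-- A finite simple graph is 2-connected if it has at least three vertices, is connected, and
remains connected after the deletion of any single vertex. -/
def IsTwoConnected {V : Type*} [Fintype V] (G : SimpleGraph V) : Prop :=
  3 ≤ Fintype.card V ∧ G.Connected ∧ ∀ v : V, (G.induce ({v}ᶜ : Set V)).Connected

/-- `G` contains no cycle of length at least `k`. -/
def LongCycleFree {V : Type*} (G : SimpleGraph V) (k : ℕ) : Prop :=
  ∀ (v : V) (p : G.Walk v v), p.IsCycle → p.length < k

/-- The closed walk `C` is a longest cycle of `G`. (The length of a cycle, its number of edges,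
is also its number of vertices.) -/
def IsLongestCycle {V : Type*} {G : SimpleGraph V} {v : V} (C : G.Walk v v) : Prop :=
  C.IsCycle ∧ ∀ (w : V) (p : G.Walk w w), p.IsCycle → p.length ≤ C.length

/-- The number of neighbours of `u` on the walk `C`. -/
noncomputable def degOn {V : Type*} {G : SimpleGraph V} {v : V} (C : G.Walk v v) (u : V) : ℕ :=
  {w : V | w ∈ C.support ∧ G.Adj u w}.ncard

/-- The Turán number `ex(n, K_r)`. -/
noncomputable def exClique (n r : ℕ) : ℕ :=
  SimpleGraph.extremalNumber n (⊤ : SimpleGraph (Fin r))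

end CliqueCircumference

/-! Let `c` be the length of the longest cycle and `K` its vertex set. By maximality a vertex off
`K` has no two consecutive neighbours on the cycle, hence at most `c / 2` neighbours in `K`.

Edges with an end off `K` are counted by peeling (`CycleOn.two_mul_edgesIn_le`). If `2 * (c / 2) ≤ w
+ 1` and every outer vertex has at most `w / 2` neighbours in `K`, then the peeled vertices cost `w
/ 2` edges each on average. A vertex of current degree at most `w / 2` is removed alone. When none
is left, two adjacent vertices of degree exactly `c / 2` exist (`CycleOn.exists_adj_card_eq`) and
are removed together; their common edge is counted once, which is the source of the half in `t -
1/2`.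

Such a pair exists because otherwise some outer vertex with the most neighbours in `K` would start a
path outside `K`, leading back to `K`, long enough to lengthen the cycle. The paths come from
`Link.linkedBy`, a form of the theorem that a 2-connected graph with large degrees has a long path
between any two vertices: the two ends are imagined as extra vertices, adjacent to each other, one
joined to `S` and one to `A`.

Inside `K`, suppose an outer vertex has `t` neighbours on a cycle of length `2 * t` or `2 * t + 1`.
These neighbours span no `K_{r-1}` and their successors are independent, so `CycleOn.edgesIn_le`
together with `w = 2 * t` gives (1) and (2). Without such a vertex, `w = 2 * t - 1` and the edges in
`K` are bounded by `ex(c, K_r)`; if `c = k - 2`, the one additional outer vertex is paid for by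
`exClique_add_le`. For `c ≤ 2 * t - 1`, counting all pairs in `K` and taking `w = c` gives the first
term of the maximum. -/

namespace CliqueCircumference

/-! ### Long paths between two vertex sets under a degree condition. -/

section Links

open scoped Classical

variable {V : Type*} {G : SimpleGraph V}

/-- No edge of `G` leads from `Y` to the rest of `W`. -/
def ClosedIn (G : SimpleGraph V) (W Y : Finset V) : Prop :=
  ∀ y ∈ Y, ∀ x ∈ W, G.Adj y x → x ∈ Y

/-- There is a path of `G` inside `W` from `S` to `A` with at least `d` vertices. -/
def LinkedBy (G : SimpleGraph V) (W S A : Finset V) (d : ℕ) : Prop :=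
  ∃ l : List V, l.IsChain G.Adj ∧ l.Nodup ∧ (∀ x ∈ l, x ∈ W) ∧ (∃ s ∈ S, l.head? = some s) ∧
    (∃ a ∈ A, l.getLast? = some a) ∧ d ≤ l.length

theorem LinkedBy.mono {W W' S S' A A' : Finset V} {d d' : ℕ} (h : LinkedBy G W S A d)
    (hW : W ⊆ W') (hS : S ⊆ S') (hA : A ⊆ A') (hd : d' ≤ d) : LinkedBy G W' S' A' d' := by
  obtain ⟨l, h1, h2, h3, ⟨s, hs, hs'⟩, ⟨a, ha, ha'⟩, h6⟩ := h
  exact ⟨l, h1, h2, fun x hx => hW (h3 x hx), ⟨s, hS hs, hs'⟩, ⟨a, hA ha, ha'⟩, hd.trans h6⟩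

theorem LinkedBy.symm {W S A : Finset V} {d : ℕ} (h : LinkedBy G W S A d) :
    LinkedBy G W A S d := by
  obtain ⟨l, h1, h2, h3, h4, h5, h6⟩ := h
  refine ⟨l.reverse, ?_, by simpa using h2, by simpa using h3, by simpa using h5,
    by simpa using h4, by simpa using h6⟩
  rw [List.isChain_reverse]
  exact h1.imp fun a b h => h.symm

theorem LinkedBy.append {W₁ W₂ S A₁ S₂ A : Finset V} {d₁ d₂ : ℕ} (h₁ : LinkedBy G W₁ S A₁ d₁)
    (h₂ : LinkedBy G W₂ S₂ A d₂) (hW : Disjoint W₁ W₂)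
    (hadj : ∀ a ∈ A₁, ∀ s ∈ S₂, G.Adj a s) : LinkedBy G (W₁ ∪ W₂) S A (d₁ + d₂) := by
  obtain ⟨l, h1, h2, h3, ⟨s, hs, hs'⟩, ⟨a, ha, ha'⟩, h6⟩ := h₁
  obtain ⟨l', k1, k2, k3, ⟨s₂, ks, ks'⟩, ⟨a₂, ka, ka'⟩, k6⟩ := h₂
  refine ⟨l ++ l', ?_, ?_, ?_, ⟨s, hs, by simp [hs']⟩, ⟨a₂, ka, by simp [ka']⟩, ?_⟩
  · rw [List.isChain_append]
    refine ⟨h1, k1, ?_⟩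
    intro x hx y hy
    rw [ha'] at hx; rw [ks'] at hy
    cases hx; cases hy
    exact hadj _ ha _ ks
  · rw [List.nodup_append]
    refine ⟨h2, k2, fun x hx y hy hxy => ?_⟩
    subst hxy
    exact Finset.disjoint_left.mp hW (h3 x hx) (k3 x hy)
  · intro x hx
    rcases List.mem_append.mp hx with hx | hx
    · exact Finset.mem_union_left _ (h3 x hx)
    · exact Finset.mem_union_right _ (k3 x hx)
  · simp; omega

/-- The vertices reachable from `x` by a path in `W` form a closed set: a path is extended along an
edge, or cut short if the new vertex already lies on it. -/
theorem linkedBy_of_closedIn {W A : Finset V} {x : V} (hx : x ∈ W)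
    (h : ∀ Y ⊆ W, x ∈ Y → ClosedIn G W Y → ∃ y ∈ Y, y ∈ A) : LinkedBy G W {x} A 1 := by
  obtain ⟨y, hy, hyA⟩ := h (W.filter fun y => LinkedBy G W {x} {y} 1) (Finset.filter_subset _ _)
    (by
      rw [Finset.mem_filter]
      exact ⟨hx, [x], by simp, by simp, by simpa using hx, by simp, by simp, by simp⟩)
    (by
      intro y hy z hz hyz
      rw [Finset.mem_filter] at hy ⊢
      refine ⟨hz, ?_⟩
      obtain ⟨-, l, h1, h2, h3, ⟨s, hs, hs'⟩, ⟨a, ha, ha'⟩, h6⟩ := hy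
      obtain rfl := Finset.mem_singleton.mp ha
      by_cases hzl : z ∈ l
      · obtain ⟨p, q, rfl⟩ := List.append_of_mem hzl
        have e : p ++ z :: q = (p ++ [z]) ++ q := by simp
        rw [e] at h1 h2 h3 hs'
        refine ⟨p ++ [z], (List.isChain_append.mp h1).1, (List.nodup_append.mp h2).1,
          fun x hx => h3 x (List.mem_append_left _ hx), ⟨s, hs, ?_⟩, by simp, by simp⟩
        cases p <;> simpa using hs'
      · refine ⟨l ++ [z], ?_, ?_, ?_, ⟨s, hs, by simp [hs']⟩, by simp, by simp⟩
        · rw [List.isChain_append]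
          refine ⟨h1, by simp, ?_⟩
          intro x hx y hy
          rw [ha'] at hx
          cases hx
          simp at hy
          exact hy ▸ hyz
        · rw [List.nodup_append]
          refine ⟨h2, by simp, ?_⟩
          intro x hx y hy hxy
          simp at hy
          subst hy hxy
          exact hzl hx
        · intro x hx
          rcases List.mem_append.mp hx with hx | hx
          · exact h3 x hx
          · simp at hx; exact hx ▸ hz)
  exact (Finset.mem_filter.mp hy).2.mono subset_rfl subset_rfl (by simpa using hyA) le_rfl

/-- The hypotheses under which `X` forces a long path inside `W` from `S` to `A`: nothing in `W` is
cut off from `S` and `A` by at most one vertex, and the vertices of `X` have large degree in `X`,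
where membership in `S ∪ F` counts as one more neighbour. -/
structure Link (G : SimpleGraph V) (W S A F X : Finset V) (d : ℕ) : Prop where
  sub : X ⊆ W
  nonempty : X.Nonempty
  exits : F ⊆ A
  meets : ∀ Y ⊆ W, Y.Nonempty → ClosedIn G W Y → (∃ y ∈ Y, y ∈ S) ∧ ∃ y ∈ Y, y ∈ A
  meets_erase : ∀ z ∈ W, ∀ Y ⊆ W.erase z, Y.Nonempty → ClosedIn G (W.erase z) Y →
    ∃ y ∈ Y, y ∈ S ∨ y ∈ A
  degree : ∀ x ∈ X, d ≤ (X.filter (G.Adj x)).card + if x ∈ S ∨ x ∈ F then 1 else 0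

/-- No proper part of `W` is closed. -/
def Unsplit (G : SimpleGraph V) (W : Finset V) : Prop :=
  ∀ Y ⊆ W, Y.Nonempty → ClosedIn G W Y → Y = W

theorem Link.restrict {W S A F X Y : Finset V} {d : ℕ} (h : Link G W S A F X d) (hY : Y ⊆ W)
    (hc : ClosedIn G W Y) (hX : (X ∩ Y).Nonempty) : Link G Y S A F (X ∩ Y) d where
  sub := Finset.inter_subset_right
  nonempty := hX
  exits := h.exits
  meets Z hZ hn hZc := h.meets Z (hZ.trans hY) hn fun z hz x hx hzx =>
    hZc z hz x (hc z (hZ hz) x hx hzx) hzx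
  meets_erase z hz Z hZ hn hZc := by
    refine h.meets_erase z (hY hz) Z (hZ.trans (Finset.erase_subset_erase _ hY)) hn ?_
    intro y hy x hx hyx
    refine hZc y hy x ?_ hyx
    rw [Finset.mem_erase] at hx ⊢
    exact ⟨hx.1, hc y (Finset.mem_of_mem_erase (hZ hy)) x hx.2 hyx⟩
  degree x hx := by
    have e : (X ∩ Y).filter (G.Adj x) = X.filter (G.Adj x) := by
      ext y
      simp only [Finset.mem_filter, Finset.mem_inter] at hx ⊢
      exact ⟨fun k => ⟨k.1.1, k.2⟩, fun k => ⟨⟨k.1, hc x hx.2 y (h.sub k.1) k.2⟩, k.2⟩⟩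
    rw [e]
    exact h.degree x (Finset.mem_inter.mp hx).1

/-- Either an instance is rigid, or it reduces to a smaller one. -/
theorem Link.reduce {W S A F X : Finset V} {d : ℕ} (h : Link G W S A F X d) :
    (Unsplit G W ∧ ∀ z ∈ W, ∀ J ⊆ W.erase z, J.Nonempty → ClosedIn G (W.erase z) J →
      ∃ y ∈ J, y ∈ A) ∨
    ∃ W' S' A' F' X' d', W'.card < W.card ∧ Link G W' S' A' F' X' d' ∧ (F = ∅ → F' = ∅) ∧
      (LinkedBy G W' S' A' d' → LinkedBy G W S A d) := by
  by_cases hu : Unsplit G W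
  swap
  · right
    unfold Unsplit at hu
    push Not at hu
    obtain ⟨Y, hY, hYn, hYc, hYW⟩ := hu
    have key : ∀ Z ⊆ W, Z ≠ W → ClosedIn G W Z → (X ∩ Z).Nonempty →
        ∃ W' S' A' F' X' d', W'.card < W.card ∧ Link G W' S' A' F' X' d' ∧ (F = ∅ → F' = ∅) ∧
          (LinkedBy G W' S' A' d' → LinkedBy G W S A d) := by
      intro Z hZ hZW hZc hZX
      exact ⟨Z, S, A, F, X ∩ Z, d, Finset.card_lt_card (hZ.ssubset_of_ne hZW),
        h.restrict hZ hZc hZX, id, fun k => k.mono hZ subset_rfl subset_rfl le_rfl⟩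
    -- By symmetry of adjacency the complement of `Y` in `W` is closed too, and one of the two parts
    -- meets `X`.
    by_cases hXY : (X ∩ Y).Nonempty
    · exact key Y hY hYW hYc hXY
    · refine key (W \ Y) Finset.sdiff_subset ?_ ?_ ?_
      · intro e
        obtain ⟨y, hy⟩ := hYn
        have : y ∈ W \ Y := e.symm ▸ hY hy
        exact (Finset.mem_sdiff.mp this).2 hy
      · intro y hy x hx hyx
        rw [Finset.mem_sdiff] at hy ⊢
        exact ⟨hx, fun hxY => hy.2 (hYc x hxY y hy.1 hyx.symm)⟩
      · obtain ⟨x, hx⟩ := h.nonempty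
        refine ⟨x, Finset.mem_inter.mpr ⟨hx, Finset.mem_sdiff.mpr ⟨h.sub hx, fun hxY => ?_⟩⟩⟩
        exact hXY ⟨x, Finset.mem_inter.mpr ⟨hx, hxY⟩⟩
  by_cases hr : ∀ z ∈ W, ∀ J ⊆ W.erase z, J.Nonempty → ClosedIn G (W.erase z) J →
      ∃ y ∈ J, y ∈ A
  · exact Or.inl ⟨hu, hr⟩
  right
  push Not at hr
  obtain ⟨z, hz, J, hJ, hJn, hJc, hJA⟩ := hr
  have hzJ : z ∉ J := fun hzJ => (Finset.mem_erase.mp (hJ hzJ)).1 rfl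
  have hJW : J ⊆ W := hJ.trans (Finset.erase_subset _ _)
  have hJc' : ∀ y ∈ J, ∀ x ∈ W, G.Adj y x → x ∈ J ∨ x = z := by
    intro y hy x hx hyx
    by_cases hxz : x = z
    · exact Or.inr hxz
    · exact Or.inl (hJc y hy x (Finset.mem_erase.mpr ⟨hxz, hx⟩) hyx)
  -- the part of `W` outside `J` still leads to `A`
  have hrest : ∀ Y ⊆ W \ J, z ∈ Y → ClosedIn G (W \ J) Y → ∃ y ∈ Y, y ∈ A := by
    intro Y hY hzY hYc
    have hcl : ClosedIn G W (Y ∪ J) := by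
      intro y hy x hx hyx
      rw [Finset.mem_union] at hy ⊢
      by_cases hxJ : x ∈ J
      · exact Or.inr hxJ
      rcases hy with hy | hy
      · exact Or.inl (hYc y hy x (Finset.mem_sdiff.mpr ⟨hx, hxJ⟩) hyx)
      · rcases hJc' y hy x hx hyx with k | rfl
        · exact Or.inr k
        · exact Or.inl hzY
    have hsub : Y ∪ J ⊆ W := Finset.union_subset (hY.trans Finset.sdiff_subset) hJW
    obtain ⟨y, hy, hyA⟩ := (h.meets (Y ∪ J) hsub ⟨z, Finset.mem_union_left _ hzY⟩ hcl).2
    rcases Finset.mem_union.mp hy with hy | hy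
    · exact ⟨y, hy, hyA⟩
    · exact absurd hyA (hJA y hy)
  have htail : LinkedBy G (W \ J) {z} A 1 :=
    linkedBy_of_closedIn (Finset.mem_sdiff.mpr ⟨hz, hzJ⟩) hrest
  -- closed parts of `J` meet `S` and see `z`
  have hJS : ∀ Y ⊆ J, Y.Nonempty → ClosedIn G J Y → (∃ y ∈ Y, y ∈ S) ∧ ∃ y ∈ Y, G.Adj y z := by
    intro Y hY hYn hYc
    constructor
    · obtain ⟨y, hy, hyS | hyA⟩ := h.meets_erase z hz Y (hY.trans hJ) hYn
        (fun y hy x hx hyx => hYc y hy x (hJc y (hY hy) x hx hyx) hyx)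
      · exact ⟨y, hy, hyS⟩
      · exact absurd hyA (hJA y (hY hy))
    · by_contra hno
      push Not at hno
      have : Y = W := hu Y (hY.trans hJW) hYn fun y hy x hx hyx => by
        rcases hJc' y (hY hy) x hx hyx with k | rfl
        · exact hYc y hy x k hyx
        · exact absurd hyx (hno y hy)
      exact hzJ (hY (this ▸ hz))
  have hdisj : Disjoint J (W \ J) := Finset.disjoint_sdiff
  have hunion : J ∪ W \ J ⊆ W := Finset.union_subset hJW Finset.sdiff_subset
  -- If `X` meets `J`, work inside `J` with the neighbours of `z` as targets, then continue through
  -- `z` to `A`. Losing `z` costs each degree at most one, as does passing to `d - 1`; `F` can be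
  -- emptied because `F ⊆ A` misses `J`.
  by_cases hXJ : (X ∩ J).Nonempty
  · refine ⟨J, S, W.filter fun y => G.Adj y z, ∅, X ∩ J, d - 1,
      Finset.card_lt_card (hJW.ssubset_of_ne fun e => hzJ (e ▸ hz)), ?_, fun _ => rfl, ?_⟩
    · refine ⟨Finset.inter_subset_right, hXJ, by simp, ?_, ?_, ?_⟩
      · intro Y hY hYn hYc
        obtain ⟨h1, y, hy, hyz⟩ := hJS Y hY hYn hYc
        exact ⟨h1, y, hy, Finset.mem_filter.mpr ⟨hJW (hY hy), hyz⟩⟩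
      · intro w hw Y hY hYn hYc
        by_contra hno
        push Not at hno
        have hYJ : Y ⊆ J := hY.trans (Finset.erase_subset _ _)
        obtain ⟨y, hy, hyS | hyA⟩ := h.meets_erase w (hJW hw) Y
          (hY.trans (Finset.erase_subset_erase _ hJW)) hYn (by
            intro y hy x hx hyx
            rw [Finset.mem_erase] at hx
            rcases hJc' y (hYJ hy) x hx.2 hyx with k | rfl
            · exact hYc y hy x (Finset.mem_erase.mpr ⟨hx.1, k⟩) hyx
            · exact absurd (Finset.mem_filter.mpr ⟨hJW (hYJ hy), hyx⟩) (hno y hy).2)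
        · exact (hno y hy).1 hyS
        · exact hJA y (hYJ hy) hyA
      · intro x hx
        rw [Finset.mem_inter] at hx
        have hxd := h.degree x hx.1
        have hxF : x ∉ F := fun k => hJA x hx.2 (h.exits k)
        have hsub : X.filter (G.Adj x) ⊆ insert z ((X ∩ J).filter (G.Adj x)) := by
          intro y hy
          rw [Finset.mem_filter] at hy
          rcases hJc' x hx.2 y (h.sub hy.1) hy.2 with k | rfl
          · exact Finset.mem_insert_of_mem
              (Finset.mem_filter.mpr ⟨Finset.mem_inter.mpr ⟨hy.1, k⟩, hy.2⟩)
          · exact Finset.mem_insert_self _ _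
        have hcard := (Finset.card_le_card hsub).trans (Finset.card_insert_le _ _)
        simp only [hxF, or_false, Finset.notMem_empty] at hxd ⊢
        omega
    · intro k
      exact (k.append htail hdisj (by
        intro a ha s hs
        rw [Finset.mem_singleton.mp hs]
        exact (Finset.mem_filter.mp ha).2)).mono hunion subset_rfl subset_rfl (by omega)
  · have hXJ' : ∀ x ∈ X, x ∉ J := fun x hx hxJ => hXJ ⟨x, Finset.mem_inter.mpr ⟨hx, hxJ⟩⟩
    -- Here `J` is only a corridor from `S` to `z`: drop it and let `z` be a start. A path that
    -- starts at `z` is later prolonged backwards through `J` to `S`.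
    refine ⟨W \ J, insert z S, A, F, X, d, Finset.card_lt_card (Finset.sdiff_ssubset hJW hJn), ?_,
      id, ?_⟩
    · refine ⟨fun x hx => Finset.mem_sdiff.mpr ⟨h.sub hx, hXJ' x hx⟩, h.nonempty, h.exits, ?_, ?_,
        ?_⟩
      · intro Y hY hYn hYc
        have hzY : z ∈ Y := by
          by_contra hzY
          have : Y = W := hu Y (hY.trans Finset.sdiff_subset) hYn fun y hy x hx hyx => by
            by_cases hxJ : x ∈ J
            · rcases hJc' x hxJ y (Finset.mem_sdiff.mp (hY hy)).1 hyx.symm with k | rfl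
              · exact absurd k (Finset.mem_sdiff.mp (hY hy)).2
              · exact absurd hy hzY
            · exact hYc y hy x (Finset.mem_sdiff.mpr ⟨hx, hxJ⟩) hyx
          exact hzY (this ▸ hz)
        exact ⟨⟨z, hzY, Finset.mem_insert_self _ _⟩, hrest Y hY hzY hYc⟩
      · intro w hw Y hY hYn hYc
        by_cases hzY : z ∈ Y
        · exact ⟨z, hzY, Or.inl (Finset.mem_insert_self _ _)⟩
        have hYJ : ∀ y ∈ Y, y ∈ W ∧ y ∉ J := fun y hy =>
          Finset.mem_sdiff.mp (Finset.mem_of_mem_erase (hY hy))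
        obtain ⟨y, hy, hyS | hyA⟩ := h.meets_erase w (Finset.mem_sdiff.mp hw).1 Y
          (hY.trans (Finset.erase_subset_erase _ Finset.sdiff_subset)) hYn (by
            intro y hy x hx hyx
            rw [Finset.mem_erase] at hx
            by_cases hxJ : x ∈ J
            · rcases hJc' x hxJ y (hYJ y hy).1 hyx.symm with k | rfl
              · exact absurd k (hYJ y hy).2
              · exact absurd hy hzY
            · exact hYc y hy x
                (Finset.mem_erase.mpr ⟨hx.1, Finset.mem_sdiff.mpr ⟨hx.2, hxJ⟩⟩) hyx)
        · exact ⟨y, hy, Or.inl (Finset.mem_insert_of_mem hyS)⟩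
        · exact ⟨y, hy, Or.inr hyA⟩
      · intro x hx
        refine (h.degree x hx).trans (Nat.add_le_add_left ?_ _)
        by_cases k : x ∈ S ∨ x ∈ F
        · rw [if_pos k, if_pos (k.imp_left (Finset.mem_insert_of_mem ·))]
        · rw [if_neg k]
          exact Nat.zero_le _
    · rintro ⟨l, h1, h2, h3, ⟨s, hs, hs'⟩, h5, h6⟩
      rcases Finset.mem_insert.mp hs with rfl | hs
      · obtain ⟨-, j, hj, hjz⟩ := hJS J subset_rfl hJn fun y hy x hx _ => hx
        have hhead : LinkedBy G J {j} S 1 := by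
          refine linkedBy_of_closedIn hj fun Y hY hjY hYc => (hJS Y hY ⟨j, hjY⟩ hYc).1
        have k : LinkedBy G (W \ J) {s} A d := ⟨l, h1, h2, h3, ⟨s, by simp, hs'⟩, h5, h6⟩
        exact (hhead.symm.append k hdisj (by
          intro a ha b hb
          rw [Finset.mem_singleton.mp ha, Finset.mem_singleton.mp hb]
          exact hjz)).mono hunion subset_rfl subset_rfl (by omega)
      · exact ⟨l, h1, h2, fun x hx => (Finset.mem_sdiff.mp (h3 x hx)).1, ⟨s, hs, hs'⟩, h5, h6⟩

/-- Stepping from a start vertex `s` of a rigid instance to its neighbours. -/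
theorem Link.step {W S A F X : Finset V} {d : ℕ} (h : Link G W S A F X d) (hu : Unsplit G W)
    (hr : ∀ z ∈ W, ∀ J ⊆ W.erase z, J.Nonempty → ClosedIn G (W.erase z) J → ∃ y ∈ J, y ∈ A)
    {s : V} (hs : s ∈ W) (hsS : s ∈ S)
    (hd : ∀ x ∈ X, x ≠ s → d ≤ (X.filter (G.Adj x)).card + 1)
    (hnext : ∀ (S' X' : Finset V) (d' : ℕ), Link G (W.erase s) S' A ∅ X' d' →
      LinkedBy G (W.erase s) S' A d') :
    LinkedBy G W S A d := by
  have hsee : ∀ Y ⊆ W.erase s, Y.Nonempty → ClosedIn G (W.erase s) Y → ∃ y ∈ Y, G.Adj y s := by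
    intro Y hY hYn hYc
    by_contra hno
    push Not at hno
    have : Y = W := hu Y (hY.trans (Finset.erase_subset _ _)) hYn fun y hy x hx hyx => by
      by_cases hxs : x = s
      · exact absurd (hxs ▸ hyx) (hno y hy)
      · exact hYc y hy x (Finset.mem_erase.mpr ⟨hxs, hx⟩) hyx
    exact (Finset.mem_erase.mp (hY (this.symm ▸ hs))).1 rfl
  by_cases hX : (X.erase s).Nonempty
  · have key := hnext (W.filter fun y => G.Adj y s) (X.erase s) (d - 1)
      ⟨Finset.erase_subset_erase _ h.sub, hX, by simp, ?_, ?_, ?_⟩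
    · have hone : LinkedBy G {s} {s} {s} 1 :=
        ⟨[s], by simp, by simp, by simp, by simp, by simp, by simp⟩
      refine (hone.append key (by simp) ?_).mono ?_ (by simpa using hsS) subset_rfl (by omega)
      · intro a ha b hb
        rw [Finset.mem_singleton.mp ha]
        exact (Finset.mem_filter.mp hb).2.symm
      · exact Finset.union_subset (by simpa using hs) (Finset.erase_subset _ _)
    · intro Y hY hYn hYc
      obtain ⟨y, hy, hys⟩ := hsee Y hY hYn hYc
      exact ⟨⟨y, hy, Finset.mem_filter.mpr ⟨Finset.mem_of_mem_erase (hY hy), hys⟩⟩,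
        hr s hs Y hY hYn hYc⟩
    · intro z hz Y hY hYn hYc
      by_contra hno
      push Not at hno
      have hYW : ∀ y ∈ Y, y ≠ z ∧ y ≠ s ∧ y ∈ W := fun y hy => by
        simpa using hY hy
      obtain ⟨y, hy, hyA⟩ := hr z (Finset.mem_of_mem_erase hz) Y
        (hY.trans (Finset.erase_subset_erase _ (Finset.erase_subset _ _))) hYn (by
          intro y hy x hx hyx
          rw [Finset.mem_erase] at hx
          by_cases hxs : x = s
          · exact absurd (Finset.mem_filter.mpr ⟨(hYW y hy).2.2, hxs ▸ hyx⟩) (hno y hy).1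
          · exact hYc y hy x (by simp [hx.1, hx.2, hxs]) hyx)
      exact (hno y hy).2 hyA
    · intro x hx
      rw [Finset.mem_erase] at hx
      have h1 := hd x hx.2 hx.1
      have e : (X.erase s).filter (G.Adj x) = (X.filter (G.Adj x)).erase s := by
        ext y; simp; tauto
      rw [e]
      by_cases hxs : G.Adj x s
      · have : x ∈ W.filter fun y => G.Adj y s := Finset.mem_filter.mpr ⟨h.sub hx.2, hxs⟩
        rw [if_pos (Or.inl this)]
        have := Finset.pred_card_le_card_erase (s := X.filter (G.Adj x)) (a := s)
        omega
      · rw [Finset.erase_eq_of_notMem (by simp [hxs])]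
        omega
  · have hXs : X = {s} := by
      obtain ⟨x, hx⟩ := h.nonempty
      have : ∀ y ∈ X, y = s := fun y hy => by
        by_contra hys
        exact hX ⟨y, Finset.mem_erase.mpr ⟨hys, hy⟩⟩
      exact Finset.eq_singleton_iff_unique_mem.mpr ⟨this x hx ▸ hx, this⟩
    -- With `X = {s}` the degree condition forces `d ≤ 1`, so any path from `s` to `A` will do.
    have hds := h.degree s (by simp [hXs])
    rw [hXs, if_pos (Or.inl hsS)] at hds
    have : (({s} : Finset V).filter (G.Adj s)) = ∅ := by
      ext y; simp only [Finset.mem_filter, Finset.mem_singleton, Finset.notMem_empty, iff_false]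
      rintro ⟨rfl, k⟩
      exact G.loopless.irrefl _ k
    rw [this] at hds
    exact (linkedBy_of_closedIn hs fun Y hY hsY hYc => (h.meets Y hY ⟨s, hsY⟩ hYc).2).mono
      subset_rfl (by simpa using hsS) subset_rfl (by simpa using hds)

/-- As `X` misses `S`, a bonus can only come from `F ⊆ A`. Once the path is read backwards it is a
bonus for starts, and no exits are needed. -/
theorem Link.swap {W S A F X : Finset V} {d : ℕ} (h : Link G W S A F X d)
    (hX : ∀ x ∈ X, x ∉ S) : Link G W A S ∅ X d where
  sub := h.sub
  nonempty := h.nonempty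
  exits := by simp
  meets Y hY hn hc := (h.meets Y hY hn hc).symm
  meets_erase z hz Y hY hn hc := by
    obtain ⟨y, hy, k⟩ := h.meets_erase z hz Y hY hn hc
    exact ⟨y, hy, k.symm⟩
  degree x hx := by
    refine (h.degree x hx).trans (Nat.add_le_add_left ?_ _)
    by_cases k : x ∈ F
    · rw [if_pos (Or.inr k), if_pos (Or.inl (h.exits k))]
    · rw [if_neg (by simp [k, hX x hx])]
      exact Nat.zero_le _

theorem Link.exists_start {W S A F X : Finset V} {d : ℕ} (h : Link G W S A F X d) :
    ∃ s ∈ W, s ∈ S :=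
  (h.meets W subset_rfl (h.nonempty.mono h.sub) fun _ _ _ hx _ => hx).1

/-- Induction on `W`. The case `F = ∅` sustains itself, because both the reductions and the step
from a start keep `F` empty. -/
theorem Link.linkedBy_of_starts (n : ℕ) : ∀ (W S A X : Finset V) (d : ℕ), W.card = n →
    Link G W S A ∅ X d → LinkedBy G W S A d := by
  induction n using Nat.strong_induction_on with
  | _ n ih =>
    intro W S A X d hn h
    rcases h.reduce with ⟨hu, hr⟩ | ⟨W', S', A', F', X', d', hlt, h', hF, himp⟩
    · obtain ⟨s, hs, hsS⟩ := h.exists_start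
      refine h.step hu hr hs hsS (fun x hx _ => (h.degree x hx).trans ?_) ?_
      · split_ifs <;> omega
      · intro S' X' d' h'
        exact ih _ (hn ▸ Finset.card_erase_lt_of_mem hs) _ _ _ _ _ rfl h'
    · obtain rfl := hF rfl
      exact himp (ih _ (hn ▸ hlt) _ _ _ _ _ rfl h')

/-- In a rigid instance either `X` contains a start, from which one steps, or the roles of `S` and
`A` are exchanged and the case without exits applies. -/
theorem Link.linkedBy {W S A F X : Finset V} {d : ℕ} (h : Link G W S A F X d) :
    LinkedBy G W S A d := by
  generalize hn : W.card = n
  induction n using Nat.strong_induction_on generalizing W S A F X d with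
  | _ n ih =>
    rcases h.reduce with ⟨hu, hr⟩ | ⟨W', S', A', F', X', d', hlt, h', -, himp⟩
    · by_cases hXS : ∃ s ∈ X, s ∈ S
      · obtain ⟨s, hs, hsS⟩ := hXS
        refine h.step hu hr (h.sub hs) hsS (fun x hx _ => (h.degree x hx).trans ?_) ?_
        · split_ifs <;> omega
        · intro S' X' d' h'
          exact ih _ (hn ▸ Finset.card_erase_lt_of_mem (h.sub hs)) h' rfl
      · push Not at hXS
        exact ((h.swap hXS).linkedBy_of_starts _ _ _ _ _ _ rfl).symm
    · exact himp (ih _ (hn ▸ hlt) h' rfl)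

end Links

/-! ### Periodic parametrisation of a longest cycle, and rerouting arguments. -/

section Cycles

variable {V : Type*} {G : SimpleGraph V}

/-- `f` runs periodically through a cycle of `G` of length `c`. -/
structure CycleOn (G : SimpleGraph V) (f : ℕ → V) (c : ℕ) : Prop where
  three_le : 3 ≤ c
  inj : ∀ i < c, ∀ j < c, f i = f j → i = j
  periodic : ∀ i, f (i + c) = f i
  adj : ∀ i, G.Adj (f i) (f (i + 1))

/-- Every cycle of `G`, given as a list of vertices, has length at most `c`. -/
def CircumferenceLE (G : SimpleGraph V) (c : ℕ) : Prop :=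
  ∀ l : List V, l.IsChain G.Adj → l.Nodup →
    (∀ x ∈ l.getLast?, ∀ y ∈ l.head?, G.Adj x y) → l.length ≤ c

theorem exists_isCycle_of_list (l : List V) (h3 : 3 ≤ l.length) (hc : l.IsChain G.Adj)
    (hn : l.Nodup) (hcl : ∀ x ∈ l.getLast?, ∀ y ∈ l.head?, G.Adj x y) :
    ∃ (v : V) (p : G.Walk v v), p.IsCycle ∧ p.length = l.length := by
  have hne : l ≠ [] := by rintro rfl; simp at h3
  have hadj : G.Adj (l.getLast hne) (l.head hne) :=
    hcl _ (List.getLast?_eq_some_getLast hne) _ (List.head?_eq_some_head hne)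
  have hlen : (SimpleGraph.Walk.ofSupport l hne hc).length + 1 = l.length := by
    rw [SimpleGraph.Walk.length_ofSupport]; omega
  refine ⟨_, .cons hadj (SimpleGraph.Walk.ofSupport l hne hc), ?_, by simpa using hlen⟩
  rw [SimpleGraph.Walk.isCycle_iff_isPath_tail_and_le_length]
  refine ⟨?_, ?_⟩
  · simp [SimpleGraph.Walk.isPath_def, hn]
  · simp only [SimpleGraph.Walk.length_cons]; omega

/-- Two adjacent vertices also form a closed list without being a cycle; `3 ≤ c` makes such short
lists harmless. -/
theorem circumferenceLE_of_isCycle {c : ℕ} (h3 : 3 ≤ c)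
    (h : ∀ (w : V) (p : G.Walk w w), p.IsCycle → p.length ≤ c) : CircumferenceLE G c := by
  intro l hc hn hcl
  by_cases h3' : 3 ≤ l.length
  · obtain ⟨v, p, hp, hl⟩ := exists_isCycle_of_list l h3' hc hn hcl
    exact hl ▸ h v p hp
  · omega

theorem cycleOn_of_isCycle {v : V} {C : G.Walk v v} (hC : C.IsCycle) :
    ∃ f : ℕ → V, CycleOn G f C.length ∧ ∀ w, w ∈ C.support ↔ ∃ i < C.length, f i = w := by
  have h3 := hC.three_le_length
  refine ⟨fun i => C.getVert (i % C.length), ⟨h3, ?_, ?_, ?_⟩, ?_⟩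
  · intro i hi j hj hij
    simp only [Nat.mod_eq_of_lt hi, Nat.mod_eq_of_lt hj] at hij
    exact hC.getVert_injOn' (by simp; omega) (by simp; omega) hij
  · intro i
    simp
  · intro i
    have hlt := Nat.mod_lt i (show 0 < C.length by omega)
    have key := C.adj_getVert_succ hlt
    by_cases h : i % C.length + 1 = C.length
    · have : (i + 1) % C.length = 0 := by
        rw [Nat.add_mod, Nat.mod_eq_of_lt (show 1 < C.length by omega), h, Nat.mod_self]
      simp only [this, SimpleGraph.Walk.getVert_zero]
      rw [h, SimpleGraph.Walk.getVert_length] at key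
      exact key
    · have : (i + 1) % C.length = i % C.length + 1 := by
        rw [Nat.add_mod, Nat.mod_eq_of_lt (show 1 < C.length by omega),
          Nat.mod_eq_of_lt (by omega)]
      simpa only [this] using key
  · intro w
    rw [SimpleGraph.Walk.mem_support_iff_exists_getVert]
    constructor
    · rintro ⟨n, rfl, hn⟩
      rcases hn.lt_or_eq with hn | rfl
      · exact ⟨n, hn, by simp [Nat.mod_eq_of_lt hn]⟩
      · exact ⟨0, by omega, by simp⟩
    · rintro ⟨i, hi, rfl⟩
      exact ⟨i, by simp [Nat.mod_eq_of_lt hi], hi.le⟩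

/-- The list `f a, f (a + 1), …, f (a + n - 1)`. -/
def seg (f : ℕ → V) (a n : ℕ) : List V := (List.range' a n).map f

theorem length_seg (f : ℕ → V) (a n : ℕ) : (seg f a n).length = n := by simp [seg]

theorem mem_seg {f : ℕ → V} {a n : ℕ} {x : V} :
    x ∈ seg f a n ↔ ∃ i, a ≤ i ∧ i < a + n ∧ f i = x := by
  simp [seg, and_assoc]

theorem head?_seg (f : ℕ → V) (a : ℕ) {n : ℕ} (hn : 0 < n) : (seg f a n).head? = some (f a) := by
  obtain ⟨m, rfl⟩ := Nat.exists_eq_succ_of_ne_zero hn.ne'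
  simp [seg, List.range'_succ]

theorem getLast?_seg (f : ℕ → V) (a : ℕ) {n : ℕ} (hn : 0 < n) :
    (seg f a n).getLast? = some (f (a + n - 1)) := by
  obtain ⟨m, rfl⟩ := Nat.exists_eq_succ_of_ne_zero hn.ne'
  simp [seg, List.range'_concat]

variable {f : ℕ → V} {c : ℕ}

theorem CycleOn.isChain_seg (h : CycleOn G f c) (a n : ℕ) : (seg f a n).IsChain G.Adj := by
  rw [seg, List.isChain_map]
  exact (List.isChain_range' a n 1).imp fun i j hij => by subst hij; exact h.adj i

theorem CycleOn.nodup_seg (h : CycleOn G f c) {a n : ℕ} (han : a + n ≤ c) :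
    (seg f a n).Nodup := by
  refine List.Nodup.map_on ?_ (List.nodup_range' )
  intro i hi j hj hij
  simp at hi hj
  exact h.inj i (by omega) j (by omega) hij

theorem CycleOn.shift (h : CycleOn G f c) (k : ℕ) : CycleOn G (fun i => f (i + k)) c where
  three_le := h.three_le
  inj := by
    have key : ∀ k, ∀ i < c, ∀ j < c, f (i + k) = f (j + k) → i = j := by
      intro k
      induction k with
      | zero => exact h.inj
      | succ k ih =>
        have h3 := h.three_le
        have wrap : ∀ i < c, ∃ i' < c, f (i + (k + 1)) = f (i' + k) ∧
            (i + 1 < c ∧ i' = i + 1 ∨ i + 1 = c ∧ i' = 0) := by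
          intro i hi
          rcases (show i + 1 ≤ c from hi).lt_or_eq with k1 | k1
          · exact ⟨i + 1, k1, by congr 1; omega, Or.inl ⟨k1, rfl⟩⟩
          · refine ⟨0, by omega, ?_, Or.inr ⟨k1, rfl⟩⟩
            rw [← h.periodic (0 + k)]
            congr 1; omega
        intro i hi j hj hij
        obtain ⟨i', hi', e1, o1⟩ := wrap i hi
        obtain ⟨j', hj', e2, o2⟩ := wrap j hj
        have := ih i' hi' j' hj' (by rw [← e1, ← e2, hij])
        omega
    exact key k
  periodic i := by
    have := h.periodic (i + k)
    rwa [show i + k + c = i + c + k by omega] at this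
  adj i := by
    have := h.adj (i + k)
    rwa [show i + k + 1 = i + 1 + k by omega] at this

theorem CycleOn.periodic_mul (h : CycleOn G f c) (i n : ℕ) : f (i + n * c) = f i := by
  induction n with
  | zero => simp
  | succ n ih => rw [← ih, ← h.periodic (i + n * c)]; congr 1; ring

theorem CycleOn.exists_lt (h : CycleOn G f c) (i : ℕ) : ∃ j < c, f j = f i := by
  refine ⟨i % c, Nat.mod_lt _ (by have := h.three_le; omega), ?_⟩
  conv_rhs => rw [← Nat.mod_add_div i c, mul_comm, h.periodic_mul]

theorem CycleOn.range_shift (h : CycleOn G f c) (k : ℕ) (x : V) :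
    (∃ i < c, f (i + k) = x) ↔ ∃ i < c, f i = x := by
  constructor
  · rintro ⟨i, -, rfl⟩
    exact h.exists_lt _
  · rintro ⟨i, hi, rfl⟩
    obtain ⟨j, hj, e⟩ := (h.shift k).exists_lt (i + k * c - k)
    refine ⟨j, hj, e.trans ?_⟩
    have : k ≤ k * c := Nat.le_mul_of_pos_right _ (by omega)
    rw [show i + k * c - k + k = i + k * c by omega, h.periodic_mul]

/-- The outer path `e` can replace either of the two arcs between `f i` and `f j`. Neither exchange
may lengthen the cycle, so each arc has at least `e.length` inner vertices. -/
theorem CycleOn.gap (h : CycleOn G f c) (hm : CircumferenceLE G c) {i j : ℕ} (hij : i < j)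
    (hj : j < c) {e : List V} (hc : e.IsChain G.Adj) (hn : e.Nodup) (hne : e ≠ [])
    (he : ∀ x ∈ e, ∀ i, f i ≠ x) (h1 : ∀ x ∈ e.head?, G.Adj (f i) x)
    (h2 : ∀ x ∈ e.getLast?, G.Adj (f j) x) :
    i + e.length + 1 ≤ j ∧ j + e.length + 1 ≤ i + c := by
  obtain ⟨a, ha⟩ : ∃ a, e.head? = some a := ⟨_, List.head?_eq_some_head hne⟩
  obtain ⟨b, hb⟩ : ∃ b, e.getLast? = some b := ⟨_, List.getLast?_eq_some_getLast hne⟩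
  have hia := h1 a ha
  have hjb := h2 b hb
  constructor
  · have key := hm (seg f 0 (i + 1) ++ e ++ seg f j (c - j)) ?_ ?_ ?_
    · simp only [List.length_append, length_seg] at key
      omega
    · rw [List.isChain_append, List.isChain_append]
      refine ⟨⟨h.isChain_seg _ _, hc, ?_⟩, h.isChain_seg _ _, ?_⟩
      · rw [getLast?_seg _ _ (by omega), ha]
        simpa using hia
      · rw [head?_seg _ _ (by omega), List.getLast?_append, hb]
        simpa using hjb.symm
    · rw [List.nodup_append, List.nodup_append]
      refine ⟨⟨h.nodup_seg (by omega), hn, ?_⟩, h.nodup_seg (by omega), ?_⟩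
      · rintro x hx y hy rfl
        obtain ⟨i', -, -, hi'⟩ := mem_seg.mp hx
        exact he x hy i' hi'
      · rintro x hx y hy rfl
        obtain ⟨j', hj1, hj2, rfl⟩ := mem_seg.mp hy
        rcases List.mem_append.mp hx with hx | hx
        · obtain ⟨i', hi1, hi2, hi3⟩ := mem_seg.mp hx
          have := h.inj i' (by omega) j' (by omega) hi3
          omega
        · exact he _ hx j' rfl
    · rw [List.getLast?_append, getLast?_seg _ _ (by omega), List.append_assoc, List.head?_append,
        head?_seg _ _ (by omega)]
      have := h.adj (j + (c - j) - 1)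
      rw [show j + (c - j) - 1 + 1 = 0 + c by omega, h.periodic] at this
      simpa using this
  · have key := hm (seg f i (j - i + 1) ++ e.reverse) ?_ ?_ ?_
    · simp only [List.length_append, length_seg, List.length_reverse] at key
      omega
    · rw [List.isChain_append, List.isChain_reverse]
      refine ⟨h.isChain_seg _ _, hc.imp fun _ _ k => k.symm, ?_⟩
      rw [getLast?_seg _ _ (by omega), List.head?_reverse, hb,
        show i + (j - i + 1) - 1 = j by omega]
      simpa using hjb
    · rw [List.nodup_append]
      refine ⟨h.nodup_seg (by omega), by simpa using hn, ?_⟩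
      rintro x hx y hy rfl
      obtain ⟨i', -, -, hi'⟩ := mem_seg.mp hx
      exact he x (by simpa using hy) i' hi'
    · rw [List.getLast?_append, List.getLast?_reverse, ha, List.head?_append,
        head?_seg _ _ (by omega)]
      simpa using hia.symm

/-- Otherwise run up to `f i`, through `u` to `f j`, backwards to `f (i + 1)` and across to `f (j +
1)`: a cycle of length `c + 1`. -/
theorem CycleOn.not_adj_succ (h : CycleOn G f c) (hm : CircumferenceLE G c) {i j : ℕ}
    (hij : i < j) (hj : j + 1 < c) {u : V} (hu : ∀ i, f i ≠ u) (hi' : G.Adj u (f i))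
    (hj' : G.Adj u (f j)) : ¬ G.Adj (f (i + 1)) (f (j + 1)) := by
  intro hadj
  have key := hm (seg f 0 (i + 1) ++ [u] ++ (seg f (i + 1) (j - i)).reverse ++
    seg f (j + 1) (c - j - 1)) ?_ ?_ ?_
  · simp only [List.length_append, length_seg, List.length_reverse, List.length_singleton] at key
    omega
  · rw [List.isChain_append, List.isChain_append, List.isChain_append, List.isChain_reverse]
    refine ⟨⟨⟨h.isChain_seg _ _, by simp, ?_⟩, (h.isChain_seg _ _).imp fun _ _ k => k.symm, ?_⟩,
      h.isChain_seg _ _, ?_⟩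
    · rw [getLast?_seg _ _ (by omega)]
      simpa using hi'.symm
    · rw [List.head?_reverse, getLast?_seg _ _ (by omega),
        show i + 1 + (j - i) - 1 = j by omega]
      simpa using hj'
    · rw [List.getLast?_append, List.getLast?_reverse, head?_seg _ _ (by omega),
        head?_seg _ _ (by omega)]
      simpa using hadj
  · rw [List.nodup_append, List.nodup_append, List.nodup_append]
    refine ⟨⟨⟨h.nodup_seg (by omega), by simp, ?_⟩,
      by simpa using h.nodup_seg (by omega), ?_⟩, h.nodup_seg (by omega), ?_⟩
    · rintro x hx y hy rfl
      obtain ⟨i', -, -, hi'⟩ := mem_seg.mp hx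
      exact hu i' (by simpa [hi'] using hy)
    · rintro x hx y hy rfl
      obtain ⟨j', hj1, hj2, rfl⟩ := mem_seg.mp (List.mem_reverse.mp hy)
      rcases List.mem_append.mp hx with hx | hx
      · obtain ⟨i', hi1, hi2, hi3⟩ := mem_seg.mp hx
        have := h.inj i' (by omega) j' (by omega) hi3
        omega
      · exact hu j' (by simpa using hx)
    · rintro x hx y hy rfl
      obtain ⟨j', hj1, hj2, rfl⟩ := mem_seg.mp hy
      rcases List.mem_append.mp hx with hx | hx
      · rcases List.mem_append.mp hx with hx | hx
        · obtain ⟨i', hi1, hi2, hi3⟩ := mem_seg.mp hx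
          have := h.inj i' (by omega) j' (by omega) hi3
          omega
        · exact hu j' (by simpa using hx)
      · obtain ⟨i', hi1, hi2, hi3⟩ := mem_seg.mp (List.mem_reverse.mp hx)
        have := h.inj i' (by omega) j' (by omega) hi3
        omega
  · rw [List.getLast?_append, getLast?_seg _ _ (by omega), List.append_assoc, List.append_assoc,
      List.head?_append, head?_seg _ _ (by omega)]
    have := h.adj (j + 1 + (c - j - 1) - 1)
    rw [show j + 1 + (c - j - 1) - 1 + 1 = 0 + c by omega, h.periodic] at this
    simpa using this

/-- The mirror image for predecessors, with `f (c - 1)` preceding `f 0`: from `u` run through `f 0`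
up to `f (j - 1)`, across to `f (c - 1)` and backwards to `f j`. -/
theorem CycleOn.not_adj_pred (h : CycleOn G f c) (hm : CircumferenceLE G c) {j : ℕ}
    (hj0 : 0 < j) (hj : j < c) {u : V} (hu : ∀ i, f i ≠ u) (h0' : G.Adj u (f 0))
    (hj' : G.Adj u (f j)) : ¬ G.Adj (f (j - 1)) (f (c - 1)) := by
  intro hadj
  have key := hm ([u] ++ seg f 0 j ++ (seg f j (c - j)).reverse) ?_ ?_ ?_
  · simp only [List.length_append, length_seg, List.length_reverse, List.length_singleton] at key
    omega
  · rw [List.isChain_append, List.isChain_append, List.isChain_reverse]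
    refine ⟨⟨by simp, h.isChain_seg _ _, ?_⟩, (h.isChain_seg _ _).imp fun _ _ k => k.symm, ?_⟩
    · rw [head?_seg _ _ (by omega)]
      simpa using h0'
    · rw [List.getLast?_append, getLast?_seg _ _ (by omega), List.head?_reverse,
        getLast?_seg _ _ (by omega), show j + (c - j) - 1 = c - 1 by omega]
      simpa using hadj
  · rw [List.nodup_append, List.nodup_append]
    refine ⟨⟨by simp, h.nodup_seg (by omega), ?_⟩, by simpa using h.nodup_seg (by omega), ?_⟩
    · rintro x hx y hy rfl
      obtain ⟨i', -, -, hi'⟩ := mem_seg.mp hy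
      exact hu i' (by simpa [hi'] using hx)
    · rintro x hx y hy rfl
      obtain ⟨j', hj1, hj2, rfl⟩ := mem_seg.mp (List.mem_reverse.mp hy)
      rcases List.mem_append.mp hx with hx | hx
      · exact hu j' (by simpa using hx)
      · obtain ⟨i', hi1, hi2, hi3⟩ := mem_seg.mp hx
        have := h.inj i' (by omega) j' (by omega) hi3
        omega
  · rw [List.getLast?_append, List.getLast?_reverse, head?_seg _ _ (by omega)]
    simpa using hj'.symm

end Cycles

/-! ### Outer vertices of small degree, found by means of long outer paths. -/

section Removable

open scoped Classical

variable {V : Type*} {G : SimpleGraph V}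

theorem preconnected_exit {W : Type*} {H : SimpleGraph W} (h : H.Preconnected) (P : W → Prop)
    {a b : W} (ha : P a) (hb : ¬ P b) : ∃ y x, P y ∧ ¬ P x ∧ H.Adj y x := by
  by_contra hno
  push Not at hno
  obtain ⟨p⟩ := h a b
  induction p with
  | nil => exact hb ha
  | cons hadj p ih => exact ih (by by_contra k; exact hno _ _ ha k hadj) hb

theorem IsTwoConnected.exit [Fintype V] (h : IsTwoConnected G) {Y : Finset V} (hY : Y.Nonempty)
    {x : V} (hx : x ∉ Y) : ∃ y ∈ Y, ∃ x, x ∉ Y ∧ G.Adj y x := by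
  obtain ⟨a, ha⟩ := hY
  obtain ⟨y, x, hy, hx, k⟩ := preconnected_exit h.2.1.preconnected (· ∈ Y) ha hx
  exact ⟨y, hy, x, hx, k⟩

theorem IsTwoConnected.exit_ne [Fintype V] (h : IsTwoConnected G) {Y : Finset V}
    (hY : Y.Nonempty) {z : V} (hz : z ∉ Y) {x : V} (hx : x ∉ Y) (hxz : x ≠ z) :
    ∃ y ∈ Y, ∃ x, x ∉ Y ∧ x ≠ z ∧ G.Adj y x := by
  obtain ⟨a, ha⟩ := hY
  have haz : a ≠ z := fun e => hz (e ▸ ha)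
  obtain ⟨y, x, hy, hx, k⟩ := preconnected_exit (h.2.2 z).preconnected (fun v => v.1 ∈ Y)
    (a := ⟨a, haz⟩) (b := ⟨x, hxz⟩) ha hx
  exact ⟨y, hy, x, hx, x.2, k⟩

/-- A smallest closed set containing `x` is its connected component in `R`. -/
theorem exists_unsplit {R : Finset V} {x : V} (hx : x ∈ R) :
    ∃ W ⊆ R, x ∈ W ∧ ClosedIn G R W ∧ Unsplit G W := by
  obtain ⟨W, hW, hmin⟩ := Finset.exists_min_image
    (R.powerset.filter fun W => x ∈ W ∧ ClosedIn G R W) Finset.card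
    ⟨R, by simp only [Finset.mem_filter, Finset.mem_powerset, subset_refl, true_and]
           exact ⟨hx, fun _ _ _ h _ => h⟩⟩
  simp only [Finset.mem_filter, Finset.mem_powerset] at hW hmin
  obtain ⟨hWR, hxW, hc⟩ := hW
  refine ⟨W, hWR, hxW, hc, fun Y hY hYn hYc => ?_⟩
  by_cases hxY : x ∈ Y
  · refine Finset.eq_of_subset_of_card_le hY (hmin Y ⟨hY.trans hWR, hxY, ?_⟩)
    intro y hy z hz hyz
    exact hYc y hy z (hc y (hY hy) z hz hyz) hyz
  · have h1 := hmin (W \ Y) ⟨Finset.sdiff_subset.trans hWR, Finset.mem_sdiff.mpr ⟨hxW, hxY⟩, ?_⟩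
    · have h2 := Finset.card_lt_card (Finset.sdiff_ssubset hY hYn)
      omega
    · intro y hy z hz hyz
      rw [Finset.mem_sdiff] at hy ⊢
      exact ⟨hc y hy.1 z hz hyz, fun hzY => hy.2 (hYc z hzY y hy.1 hyz.symm)⟩

/-- Halving `i - a` is injective on indices at distance at least two. -/
theorem card_le_of_spaced {T : Finset ℕ} {a b : ℕ} (hab : ∀ i ∈ T, a ≤ i ∧ i ≤ b)
    (hsp : ∀ i ∈ T, ∀ j ∈ T, i < j → i + 2 ≤ j) : 2 * T.card ≤ b - a + 2 := by
  have : T.card ≤ (Finset.range ((b - a) / 2 + 1)).card := by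
    refine Finset.card_le_card_of_injOn (fun i => (i - a) / 2) ?_ ?_
    · intro i hi
      have := hab i hi
      simp only [Finset.coe_range, Set.mem_Iio]
      omega
    · intro i hi j hj hij
      have h1 := hab i hi
      have h2 := hab j hj
      simp only at hij
      rcases lt_trichotomy i j with k | k | k
      · have := hsp i hi j hj k; omega
      · exact k
      · have := hsp j hj i hi k; omega
  rw [Finset.card_range] at this
  omega

variable {f : ℕ → V} {c : ℕ} {K : Finset V}

theorem CycleOn.notMem_of_notMem (hf : CycleOn G f c) (hK : ∀ w, w ∈ K ↔ ∃ i < c, f i = w)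
    {x : V} (hx : x ∉ K) (i : ℕ) : f i ≠ x := by
  rintro rfl
  exact hx ((hK _).mpr (hf.exists_lt i))

/-- A path outside the cycle joining two different vertices of the cycle is short. -/
theorem CycleOn.two_mul_length_le (hf : CycleOn G f c) (hm : CircumferenceLE G c)
    (hK : ∀ w, w ∈ K ↔ ∃ i < c, f i = w) {l : List V} (hc : l.IsChain G.Adj) (hn : l.Nodup)
    (hl : ∀ x ∈ l, x ∉ K) (hne : l ≠ []) {v w : V} (hv : v ∈ K) (hw : w ∈ K) (hvw : v ≠ w)
    (h1 : ∀ x ∈ l.head?, G.Adj v x) (h2 : ∀ x ∈ l.getLast?, G.Adj w x) :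
    2 * l.length + 2 ≤ c := by
  obtain ⟨i, hi, rfl⟩ := (hK v).mp hv
  obtain ⟨j, hj, rfl⟩ := (hK w).mp hw
  have hoff : ∀ x ∈ l, ∀ i, f i ≠ x := fun x hx => hf.notMem_of_notMem hK (hl x hx)
  rcases lt_trichotomy i j with k | rfl | k
  · have := hf.gap hm k hj hc hn hne hoff h1 h2
    omega
  · exact absurd rfl hvw
  · have := hf.gap hm k hi (e := l.reverse)
      (by rw [List.isChain_reverse]; exact hc.imp fun _ _ k => k.symm) (by simpa using hn)
      (by simpa using hne) (by simpa using hoff) (by simpa using h2) (by simpa using h1)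
    simp only [List.length_reverse] at this
    omega

/-- A path outside the cycle starting at a vertex with several neighbours on the cycle and ending
at a neighbour of the cycle is short. -/
theorem CycleOn.two_mul_length_add_le (hf : CycleOn G f c) (hm : CircumferenceLE G c)
    (hK : ∀ w, w ∈ K ↔ ∃ i < c, f i = w) {l : List V} (hc : l.IsChain G.Adj) (hn : l.Nodup)
    (hl : ∀ x ∈ l, x ∉ K) {x : V} (hx : l.head? = some x) {w : V} (hw : w ∈ K)
    (hlast : ∀ y ∈ l.getLast?, G.Adj w y) (h2 : 2 ≤ (K.filter (G.Adj x)).card) :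
    2 * l.length + 2 * (K.filter (G.Adj x)).card ≤ c + 2 := by
  obtain ⟨k, hk, rfl⟩ := (hK w).mp hw
  have hg := hf.shift k
  have hKg : ∀ w, w ∈ K ↔ ∃ i < c, f (i + k) = w := fun w => by
    rw [hf.range_shift]; exact hK w
  have hxl : x ∈ l := List.mem_of_head? hx
  have hne : l ≠ [] := List.ne_nil_of_mem hxl
  have hoff : ∀ x ∈ l, ∀ i, f (i + k) ≠ x := fun x hx i =>
    hf.notMem_of_notMem hK (hl x hx) (i + k)
  -- After the shift `w` has index 0, so `T` loses at most the neighbour `w`. The path `l` keeps the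
  -- remaining neighbours at distance at least `l.length + 1` from `w` both ways round, and they are
  -- pairwise non-consecutive.
  set T := (Finset.range c).filter fun i => 0 < i ∧ G.Adj x (f (i + k)) with hT
  have hcard : (K.filter (G.Adj x)).card ≤ T.card + 1 := by
    have hsub : K.filter (G.Adj x) ⊆ insert (f k) (T.image fun i => f (i + k)) := by
      intro y hy
      rw [Finset.mem_filter] at hy
      obtain ⟨i, hi, rfl⟩ := (hKg y).mp hy.1
      rcases Nat.eq_zero_or_pos i with rfl | hpos
      · simp
      · exact Finset.mem_insert_of_mem (Finset.mem_image.mpr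
          ⟨i, by simp only [hT, Finset.mem_filter, Finset.mem_range]; exact ⟨hi, hpos, hy.2⟩, rfl⟩)
    exact (Finset.card_le_card hsub).trans ((Finset.card_insert_le _ _).trans
      (Nat.add_le_add_right Finset.card_image_le _))
  have hbd : ∀ i ∈ T, l.length + 1 ≤ i ∧ i ≤ c - l.length - 1 := by
    intro i hi
    simp only [hT, Finset.mem_filter, Finset.mem_range] at hi
    have := hg.gap hm hi.2.1 hi.1 (e := l.reverse)
      (by rw [List.isChain_reverse]; exact hc.imp fun _ _ k => k.symm) (by simpa using hn)
      (by simpa using hne) (by simpa using hoff) (by simpa using hlast)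
      (by simpa [hx] using hi.2.2.symm)
    simp only [List.length_reverse] at this
    omega
  have hsp : ∀ i ∈ T, ∀ j ∈ T, i < j → i + 2 ≤ j := by
    intro i hi j hj hij
    simp only [hT, Finset.mem_filter, Finset.mem_range] at hi hj
    have := hg.gap hm hij hj.1 (e := [x]) (by simp) (by simp) (by simp)
      (by simpa using hoff x hxl) (by simpa using hi.2.2.symm) (by simpa using hj.2.2.symm)
    simp only [List.length_singleton] at this
    omega
  have key := card_le_of_spaced hbd hsp
  obtain ⟨i, hi⟩ : T.Nonempty := Finset.card_pos.mp (by omega)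
  have := hbd i hi
  omega

theorem CycleOn.two_mul_card_le (hf : CycleOn G f c) (hm : CircumferenceLE G c)
    (hK : ∀ w, w ∈ K ↔ ∃ i < c, f i = w) {x : V} (hx : x ∉ K) :
    2 * (K.filter (G.Adj x)).card ≤ c := by
  by_cases h2 : 2 ≤ (K.filter (G.Adj x)).card
  · obtain ⟨w, hw⟩ : (K.filter (G.Adj x)).Nonempty := Finset.card_pos.mp (by omega)
    rw [Finset.mem_filter] at hw
    have := hf.two_mul_length_add_le hm hK (l := [x]) (by simp) (by simp) (by simpa using hx) rfl
      hw.1 (by simpa using hw.2.symm) h2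
    simp at this
    omega
  · have := hf.three_le
    omega

theorem card_filter_union_of_disjoint {R : Finset V} (h : ∀ x ∈ R, x ∉ K) (p : V → Prop) :
    ((K ∪ R).filter p).card = (K.filter p).card + (R.filter p).card := by
  rw [Finset.filter_union, Finset.card_union_of_disjoint]
  exact Finset.disjoint_filter_filter
    (Finset.disjoint_left.mpr fun x hx hx' => h x hx' hx)

/-- Vertices outside a longest cycle cannot all have few neighbours on it and large degree. -/
theorem CycleOn.exists_two_le (hf : CycleOn G f c) (hm : CircumferenceLE G c)
    (hK : ∀ w, w ∈ K ↔ ∃ i < c, f i = w) [Fintype V] (hG : IsTwoConnected G) {R : Finset V}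
    (hR : ∀ x ∈ R, x ∉ K) (hRn : R.Nonempty)
    (hdeg : ∀ x ∈ R, c / 2 ≤ (K.filter (G.Adj x)).card + (R.filter (G.Adj x)).card) :
    ∃ x ∈ R, 2 ≤ (K.filter (G.Adj x)).card := by
  by_contra hno
  push Not at hno
  obtain ⟨x, hx⟩ := hRn
  obtain ⟨W, hWR, hxW, hWc, hWu⟩ := exists_unsplit (G := G) (R := Finset.univ \ K) (x := x)
    (by simpa using hR x hx)
  have hWK : ∀ y ∈ W, y ∉ K := fun y hy => by simpa using hWR hy
  have hout : ∀ y ∈ W, ∀ x, x ∉ W → G.Adj y x → x ∈ K := by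
    intro y hy z hz hyz
    by_contra hzK
    exact hz (hWc y hy z (by simpa using hzK) hyz)
  have h3 := hf.three_le
  have hfK : ∀ i < c, f i ∈ K := fun i hi => (hK _).mpr ⟨i, hi, rfl⟩
  -- every vertex has another vertex of the cycle next to it
  have hother : ∀ z : V, ∃ w ∈ K, w ≠ z := by
    intro z
    by_cases h : f 0 = z
    · refine ⟨f 1, hfK 1 (by omega), fun e => ?_⟩
      have := hf.inj 0 (by omega) 1 (by omega) (h.trans e.symm)
      omega
    · exact ⟨f 0, hfK 0 (by omega), h⟩
  obtain ⟨y, hy, v, hvW, hyv⟩ := hG.exit ⟨x, hxW⟩ (x := f 0) fun h => hWK _ h (hfK 0 (by omega))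
  have hvK := hout y hy v hvW hyv
  set S := W.filter fun y => G.Adj y v with hS
  set A := W.filter fun y => ∃ w ∈ K, w ≠ v ∧ G.Adj y w with hA
  -- Each vertex has at most one neighbour in `K`, which the bonus replaces exactly. A path with `c
  -- / 2` vertices between `v` and another cycle vertex is then too long, since `2 * (c / 2) + 2 >
  -- c`.
  have hlink : Link G W S A A (R ∩ W) (c / 2) := by
    refine ⟨Finset.inter_subset_right, ⟨x, Finset.mem_inter.mpr ⟨hx, hxW⟩⟩, subset_rfl, ?_, ?_, ?_⟩
    · intro Y hY hYn hYc
      rw [hWu Y hY hYn hYc]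
      refine ⟨⟨y, hy, Finset.mem_filter.mpr ⟨hy, hyv⟩⟩, ?_⟩
      obtain ⟨w, hw, hwv⟩ := hother v
      obtain ⟨a, ha, b, hb, hbv, hab⟩ := hG.exit_ne ⟨x, hxW⟩ hvW (x := w)
        (fun h => hWK _ h hw) hwv
      exact ⟨a, ha, Finset.mem_filter.mpr ⟨ha, b, hout a ha b hb hab, hbv, hab⟩⟩
    · intro z hz Y hY hYn hYc
      obtain ⟨w, hw, hwz⟩ := hother z
      have hYW : ∀ y ∈ Y, y ≠ z ∧ y ∈ W := fun y hy => by simpa using hY hy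
      obtain ⟨a, ha, b, hb, hbz, hab⟩ := hG.exit_ne hYn (z := z)
        (fun h => (hYW z h).1 rfl) (x := w) (fun h => hWK _ (hYW w h).2 hw) hwz
      have hbW : b ∉ W := fun h => hb (hYc a ha b (by simp [hbz, h]) hab)
      have hbK := hout a (hYW a ha).2 b hbW hab
      refine ⟨a, ha, ?_⟩
      by_cases hbv : b = v
      · exact Or.inl (Finset.mem_filter.mpr ⟨(hYW a ha).2, hbv ▸ hab⟩)
      · exact Or.inr (Finset.mem_filter.mpr ⟨(hYW a ha).2, b, hbK, hbv, hab⟩)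
    · intro a ha
      rw [Finset.mem_inter] at ha
      refine (hdeg a ha.1).trans ?_
      have e : R.filter (G.Adj a) ⊆ (R ∩ W).filter (G.Adj a) := by
        intro b hb
        rw [Finset.mem_filter] at hb
        refine Finset.mem_filter.mpr ⟨Finset.mem_inter.mpr ⟨hb.1, ?_⟩, hb.2⟩
        by_contra hbW
        exact hR b hb.1 (hout a ha.2 b hbW hb.2)
      have h1 := Finset.card_le_card e
      have h2 := hno a ha.1
      by_cases h0 : (K.filter (G.Adj a)).card = 0
      · omega
      · obtain ⟨b, hb⟩ := Finset.card_pos.mp (Nat.pos_of_ne_zero h0)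
        rw [Finset.mem_filter] at hb
        have : a ∈ S ∨ a ∈ A := by
          by_cases hbv : b = v
          · exact Or.inl (Finset.mem_filter.mpr ⟨ha.2, hbv ▸ hb.2⟩)
          · exact Or.inr (Finset.mem_filter.mpr ⟨ha.2, b, hb.1, hbv, hb.2⟩)
        rw [if_pos this]
        omega
  obtain ⟨l, h1, h2, h3, ⟨s, hs, hs'⟩, ⟨a, ha, ha'⟩, h6⟩ := hlink.linkedBy
  obtain ⟨w, hw, hwv, haw⟩ := (Finset.mem_filter.mp ha).2
  have := hf.two_mul_length_le hm hK h1 h2 (fun x hx => hWK x (h3 x hx))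
    (List.ne_nil_of_mem (List.mem_of_head? hs')) hvK hw hwv.symm
    (by rw [hs']; simpa using (Finset.mem_filter.mp hs).2.symm) (by rw [ha']; simpa using haw.symm)
  omega

/-- If the vertices of a set outside a longest cycle of length `c` all have degree at least `c / 2`
and a neighbour in the set, then two adjacent ones have degree exactly `c / 2`. -/
theorem CycleOn.exists_adj_card_eq (hf : CycleOn G f c) (hm : CircumferenceLE G c)
    (hK : ∀ w, w ∈ K ↔ ∃ i < c, f i = w) [Fintype V] (hG : IsTwoConnected G) {R : Finset V}
    (hR : ∀ x ∈ R, x ∉ K) (hRn : R.Nonempty)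
    (hdeg : ∀ x ∈ R, c / 2 ≤ (K.filter (G.Adj x)).card + (R.filter (G.Adj x)).card)
    (hnbr : ∀ x ∈ R, ∃ y ∈ R, G.Adj x y) :
    ∃ x ∈ R, ∃ y ∈ R, G.Adj x y ∧
      (K.filter (G.Adj x)).card + (R.filter (G.Adj x)).card = c / 2 ∧
      (K.filter (G.Adj y)).card + (R.filter (G.Adj y)).card = c / 2 := by
  by_contra hno
  push Not at hno
  obtain ⟨x₁, hx₁, hmax⟩ := Finset.exists_max_image R (fun x => (K.filter (G.Adj x)).card) hRn
  -- Among the vertices with the most neighbours in `K`, one of total degree exactly `c / 2` is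
  -- preferred. Its neighbours in `R` are then not simultaneously extremal and of degree `c / 2`, as
  -- the assumption excludes such a pair.
  obtain ⟨x₀, hx₀, hm₀, hx₀'⟩ : ∃ x₀ ∈ R,
      (K.filter (G.Adj x₀)).card = (K.filter (G.Adj x₁)).card ∧
      ∀ x ∈ R, (K.filter (G.Adj x)).card = (K.filter (G.Adj x₁)).card →
        (K.filter (G.Adj x)).card + (R.filter (G.Adj x)).card = c / 2 →
        (K.filter (G.Adj x₀)).card + (R.filter (G.Adj x₀)).card = c / 2 := by
    by_cases h : ∃ x ∈ R, (K.filter (G.Adj x)).card = (K.filter (G.Adj x₁)).card ∧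
        (K.filter (G.Adj x)).card + (R.filter (G.Adj x)).card = c / 2
    · obtain ⟨x, hx, h1, h2⟩ := h
      exact ⟨x, hx, h1, fun _ _ _ _ => h2⟩
    · push Not at h
      exact ⟨x₁, hx₁, rfl, fun x hx h1 h2 => absurd h2 (h x hx h1)⟩
  rw [← hm₀] at hmax hx₀'
  set m := (K.filter (G.Adj x₀)).card with hmdef
  have hm2 : 2 ≤ m := by
    obtain ⟨x, hx, h⟩ := hf.exists_two_le hm hK hG hR hRn hdeg
    exact h.trans (hmax x hx)
  obtain ⟨W, hWR, hxW, hWc, hWu⟩ := exists_unsplit (G := G) (R := Finset.univ \ K) (x := x₀)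
    (by simpa using hR x₀ hx₀)
  have hWK : ∀ y ∈ W, y ∉ K := fun y hy => by simpa using hWR hy
  have hout : ∀ y ∈ W, ∀ x, x ∉ W → G.Adj y x → x ∈ K := by
    intro y hy z hz hyz
    by_contra hzK
    exact hz (hWc y hy z (by simpa using hzK) hyz)
  have h3 := hf.three_le
  have hfK : ∀ i < c, f i ∈ K := fun i hi => (hK _).mpr ⟨i, hi, rfl⟩
  set S := (W.erase x₀).filter fun y => G.Adj x₀ y with hS
  set A := (W.erase x₀).filter fun y => ∃ w ∈ K, G.Adj y w with hA
  have hexit : ∀ z ∈ W, ∀ Y ⊆ W.erase z, Y.Nonempty → ∃ y ∈ Y, ∃ x, x ∉ Y ∧ x ≠ z ∧ G.Adj y x := by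
    intro z hz Y hY hYn
    refine hG.exit_ne hYn (fun h => (Finset.mem_erase.mp (hY h)).1 rfl) (x := f 0)
      (fun h => ?_) (fun h => ?_)
    · exact hWK _ (Finset.mem_of_mem_erase (hY h)) (hfK 0 (by omega))
    · exact hWK _ hz (h ▸ hfK 0 (by omega))
  -- With `x₀` in front, the path has at least `c / 2 + 2 - m` vertices, while
  -- `CycleOn.two_mul_length_add_le` allows `2 * length + 2 * m ≤ c + 2`.
  have hlink : Link G (W.erase x₀) S A A ((R ∩ W).erase x₀) (c / 2 + 1 - m) := by
    refine ⟨Finset.erase_subset_erase _ Finset.inter_subset_right, ?_, subset_rfl, ?_, ?_, ?_⟩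
    · obtain ⟨y, hy, hxy⟩ := hnbr x₀ hx₀
      refine ⟨y, Finset.mem_erase.mpr ⟨hxy.ne', Finset.mem_inter.mpr ⟨hy, ?_⟩⟩⟩
      exact hWc x₀ hxW y (by simpa using hR y hy) hxy
    · intro Y hY hYn hYc
      have hYW : ∀ y ∈ Y, y ≠ x₀ ∧ y ∈ W := fun y hy => by simpa using hY hy
      constructor
      · by_contra hS'
        push Not at hS'
        have : Y = W := hWu Y (hY.trans (Finset.erase_subset _ _)) hYn fun y hy x hx hyx => by
          by_cases hx0 : x = x₀
          · exact absurd (Finset.mem_filter.mpr ⟨hY hy, hx0 ▸ hyx.symm⟩) (hS' y hy)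
          · exact hYc y hy x (Finset.mem_erase.mpr ⟨hx0, hx⟩) hyx
        exact (hYW x₀ (this.symm ▸ hxW)).1 rfl
      · obtain ⟨a, ha, b, hb, hbz, hab⟩ := hexit x₀ hxW Y hY hYn
        have hbW : b ∉ W := fun h => hb (hYc a ha b (by simp [hbz, h]) hab)
        exact ⟨a, ha, Finset.mem_filter.mpr ⟨hY ha, b, hout a (hYW a ha).2 b hbW hab, hab⟩⟩
    · intro z hz Y hY hYn hYc
      by_contra hno
      push Not at hno
      have hYW : ∀ y ∈ Y, y ≠ z ∧ y ≠ x₀ ∧ y ∈ W := fun y hy => by simpa using hY hy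
      obtain ⟨a, ha, b, hb, hbz, hab⟩ := hexit z (Finset.mem_of_mem_erase hz) Y
        (hY.trans (Finset.erase_subset_erase _ (Finset.erase_subset _ _))) hYn
      have haW : a ∈ W.erase x₀ := Finset.mem_of_mem_erase (hY ha)
      have hb0 : b ≠ x₀ := fun e => (hno a ha).1 (Finset.mem_filter.mpr ⟨haW, e ▸ hab.symm⟩)
      have hbW : b ∉ W := fun h => hb (hYc a ha b (by simp [hbz, h, hb0]) hab)
      exact (hno a ha).2
        (Finset.mem_filter.mpr ⟨haW, b, hout a (hYW a ha).2.2 b hbW hab, hab⟩)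
    · intro a ha
      obtain ⟨ha0, haR, haW⟩ : a ≠ x₀ ∧ a ∈ R ∧ a ∈ W := by simpa using ha
      have haW' : a ∈ W.erase x₀ := Finset.mem_erase.mpr ⟨ha0, haW⟩
      have hsub : (R.filter (G.Adj a)).erase x₀ ⊆ ((R ∩ W).erase x₀).filter (G.Adj a) := by
        intro b hb
        rw [Finset.mem_erase, Finset.mem_filter] at hb
        refine Finset.mem_filter.mpr ⟨Finset.mem_erase.mpr ⟨hb.1,
          Finset.mem_inter.mpr ⟨hb.2.1, ?_⟩⟩, hb.2.2⟩
        by_contra hbW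
        exact hR b hb.2.1 (hout a haW b hbW hb.2.2)
      have h1 := Finset.card_le_card hsub
      have h2 := hmax a haR
      have h4 := hdeg a haR
      by_cases hadj : G.Adj x₀ a
      · have haS : a ∈ S := Finset.mem_filter.mpr ⟨haW', hadj⟩
        have h5 := Finset.pred_card_le_card_erase (s := R.filter (G.Adj a)) (a := x₀)
        -- A neighbour of `x₀` loses `x₀` and regains it as a start, so it needs one unit more than
        -- `c / 2 - m`. That unit is missing only in the case excluded by the choice of `x₀`.
        have h6 : ¬ ((K.filter (G.Adj a)).card = m ∧
            (K.filter (G.Adj a)).card + (R.filter (G.Adj a)).card = c / 2) := fun k =>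
          hno x₀ hx₀ a haR hadj (hx₀' a haR k.1 k.2) k.2
        rw [if_pos (Or.inl haS)]
        omega
      · rw [Finset.erase_eq_of_notMem (by simp [G.adj_comm a, hadj])] at h1
        by_cases haA : a ∈ A
        · rw [if_pos (Or.inr haA)]
          omega
        · have : (K.filter (G.Adj a)).card = 0 := by
            rw [Finset.card_eq_zero, Finset.filter_eq_empty_iff]
            exact fun w hw k => haA (Finset.mem_filter.mpr ⟨haW', w, hw, k⟩)
          omega
  obtain ⟨l, h1, h2, h3, ⟨s, hs, hs'⟩, ⟨a, ha, ha'⟩, h6⟩ := hlink.linkedBy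
  obtain ⟨w, hw, haw⟩ := (Finset.mem_filter.mp ha).2
  have hlne : l ≠ [] := List.ne_nil_of_mem (List.mem_of_head? hs')
  have hlpos := List.length_pos_iff.mpr hlne
  have := hf.two_mul_length_add_le hm hK (l := x₀ :: l) (x := x₀) (w := w)
    (by
      rw [List.isChain_cons]
      refine ⟨?_, h1⟩
      rw [hs']
      simpa using (Finset.mem_filter.mp hs).2)
    (List.nodup_cons.mpr ⟨fun h => (Finset.mem_erase.mp (h3 _ h)).1 rfl, h2⟩)
    (by
      intro x hx
      rcases List.mem_cons.mp hx with rfl | hx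
      · exact hR _ hx₀
      · exact hWK x (Finset.mem_of_mem_erase (h3 x hx)))
    rfl hw (by rw [List.getLast?_cons, ha']; simpa using haw.symm) hm2
  rw [List.length_cons] at this
  omega

end Removable

/-! ### Edge counts, Turán numbers and the peeling argument. -/

section Edges

open scoped Classical

variable {V : Type*} [Fintype V] {G : SimpleGraph V}

/-- The number of edges of `G` inside `T`. -/
noncomputable def edgesIn (G : SimpleGraph V) (T : Finset V) : ℕ :=
  (G.edgeFinset.filter fun e => ∀ v ∈ e, v ∈ T).card

theorem edgesIn_univ [Fintype G.edgeSet] : edgesIn G Finset.univ = G.edgeFinset.card := by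
  rw [edgesIn, Finset.filter_true_of_mem fun _ _ v _ => Finset.mem_univ v]
  congr!

theorem edgesIn_insert [DecidableEq V] {T : Finset V} {x : V} (hx : x ∉ T) :
    edgesIn G (insert x T) = edgesIn G T + (T.filter (G.Adj x)).card := by
  have key : edgesIn G (insert x T) = ((G.edgeFinset.filter fun e => ∀ v ∈ e, v ∈ T) ∪
      (T.filter (G.Adj x)).image fun y => s(x, y)).card := by
    rw [edgesIn]
    congr 1
    ext e
    induction e using Sym2.ind with
    | _ a b =>
      simp only [Finset.mem_filter, Finset.mem_union, Finset.mem_image, SimpleGraph.mem_edgeFinset,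
        SimpleGraph.mem_edgeSet, Sym2.mem_iff, forall_eq_or_imp, forall_eq, Finset.mem_insert,
        Sym2.eq_iff]
      constructor
      · rintro ⟨hab, rfl | ha, rfl | hb⟩
        · exact absurd hab (G.loopless.irrefl _)
        · exact Or.inr ⟨b, ⟨hb, hab⟩, Or.inl ⟨rfl, rfl⟩⟩
        · exact Or.inr ⟨a, ⟨ha, hab.symm⟩, Or.inr ⟨rfl, rfl⟩⟩
        · exact Or.inl ⟨hab, ha, hb⟩
      · rintro (⟨hab, ha, hb⟩ | ⟨y, ⟨hy, hxy⟩, ⟨rfl, rfl⟩ | ⟨rfl, rfl⟩⟩)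
        · exact ⟨hab, Or.inr ha, Or.inr hb⟩
        · exact ⟨hxy, Or.inl rfl, Or.inr hy⟩
        · exact ⟨hxy.symm, Or.inr hy, Or.inl rfl⟩
  rw [key, Finset.card_union_of_disjoint, Finset.card_image_of_injective, edgesIn]
  · congr!
  · intro y z hyz
    exact Sym2.congr_right.mp hyz
  · rw [Finset.disjoint_left]
    intro e he he'
    obtain ⟨y, -, rfl⟩ := Finset.mem_image.mp he'
    exact hx ((Finset.mem_filter.mp he).2 x (Sym2.mem_mk_left x y))

theorem edgesIn_empty : edgesIn G ∅ = 0 := by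
  rw [edgesIn, Finset.card_eq_zero, Finset.filter_eq_empty_iff]
  intro e _ h
  induction e using Sym2.ind with
  | _ a b => exact absurd (h a (Sym2.mem_mk_left a b)) (Finset.notMem_empty a)

theorem two_mul_edgesIn_le (T : Finset V) : 2 * edgesIn G T ≤ T.card * (T.card - 1) := by
  induction T using Finset.induction_on with
  | empty => simp [edgesIn_empty]
  | insert x T hx ih =>
    rw [edgesIn_insert hx, Finset.card_insert_of_notMem hx, Nat.add_sub_cancel]
    have := Finset.card_filter_le T (G.Adj x)
    rcases Nat.eq_zero_or_pos T.card with h | h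
    · rw [h] at ih this ⊢
      omega
    · obtain ⟨m, hm⟩ := Nat.exists_eq_add_of_lt h
      rw [hm] at ih this ⊢
      simp only [zero_add, Nat.add_sub_cancel] at *
      nlinarith

theorem edgesIn_erase {K R : Finset V} (hR : ∀ x ∈ R, x ∉ K) {x : V} (hx : x ∈ R) :
    edgesIn G (K ∪ R) = edgesIn G (K ∪ R.erase x) +
      ((K.filter (G.Adj x)).card + (R.filter (G.Adj x)).card) := by
  have e : K ∪ R = insert x (K ∪ R.erase x) := by
    rw [← Finset.union_insert, Finset.insert_erase hx]
  rw [e, edgesIn_insert (by simp [hR x hx]),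
    card_filter_union_of_disjoint fun y hy => hR y (Finset.mem_of_mem_erase hy)]
  congr 3
  ext y
  simp only [Finset.mem_filter, Finset.mem_erase]
  exact ⟨fun h => ⟨h.1.2, h.2⟩, fun h => ⟨⟨h.2.ne', h.1⟩, h.2⟩⟩

theorem edgesIn_union_of_independent {A I : Finset V} (hI : ∀ x ∈ I, x ∉ A)
    (hind : ∀ x ∈ I, ∀ y ∈ I, ¬ G.Adj x y) :
    edgesIn G (A ∪ I) = edgesIn G A + ∑ x ∈ I, (A.filter (G.Adj x)).card := by
  induction I using Finset.induction_on with
  | empty => simp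
  | insert x I hx ih =>
    have e : I.filter (G.Adj x) = ∅ := by
      rw [Finset.filter_eq_empty_iff]
      exact fun y hy => hind x (Finset.mem_insert_self _ _) y (Finset.mem_insert_of_mem hy)
    rw [Finset.union_insert, edgesIn_insert, ih, Finset.sum_insert hx,
      card_filter_union_of_disjoint, e, Finset.card_empty]
    · ring
    · exact fun y hy => hI y (Finset.mem_insert_of_mem hy)
    · exact fun y hy => hI y (Finset.mem_insert_of_mem hy)
    · exact fun y hy z hz => hind y (Finset.mem_insert_of_mem hy) z (Finset.mem_insert_of_mem hz)
    · rw [Finset.mem_union, not_or]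
      exact ⟨hI x (Finset.mem_insert_self _ _), hx⟩

theorem edgesIn_le_of_hom {W : Type*} [Fintype W] {H : SimpleGraph W} [Fintype H.edgeSet]
    {φ : W → V} (hφ : Function.Injective φ) {T : Finset V} (hT : ∀ a, φ a ∈ T)
    (h : ∀ a b, H.Adj a b → G.Adj (φ a) (φ b)) : H.edgeFinset.card ≤ edgesIn G T := by
  refine Finset.card_le_card_of_injOn (Sym2.map φ) ?_ (Sym2.map.injective hφ).injOn
  intro e
  induction e using Sym2.ind with
  | _ a b =>
    intro hab
    simp only [Finset.mem_coe, SimpleGraph.mem_edgeFinset, SimpleGraph.mem_edgeSet] at hab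
    simp [h a b hab, hT]

theorem edgesIn_le_card_induce (T : Finset V) :
    edgesIn G T ≤ (G.induce (T : Set V)).edgeFinset.card := by
  have hsub : (G.edgeFinset.filter fun e => ∀ v ∈ e, v ∈ T) ⊆
      (G.induce (T : Set V)).edgeFinset.image (Sym2.map Subtype.val) := by
    intro e
    induction e using Sym2.ind with
    | _ a b =>
      intro h
      simp only [Finset.mem_filter, SimpleGraph.mem_edgeFinset, SimpleGraph.mem_edgeSet,
        Sym2.mem_iff, forall_eq_or_imp, forall_eq] at h
      refine Finset.mem_image.mpr ⟨s(⟨a, h.2.1⟩, ⟨b, h.2.2⟩), ?_, rfl⟩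
      simpa using h.1
  exact (Finset.card_le_card hsub).trans Finset.card_image_le

theorem card_edgeFinset_le_exClique {W : Type*} [Fintype W] {H : SimpleGraph W}
    [Fintype H.edgeSet] {q : ℕ} (h : H.CliqueFree q) : H.edgeFinset.card ≤ exClique (Fintype.card W) q := by
  have := SimpleGraph.card_edgeFinset_le_extremalNumber (G := H)
    (H := (⊤ : SimpleGraph (Fin q))) ?_
  · rw [exClique]
    convert this
  rw [← SimpleGraph.cliqueFree_iff_top_free, Fintype.card_fin]
  exact h

theorem edgesIn_le_exClique {T : Finset V} {q : ℕ} (h : ∀ s ⊆ T, ¬ G.IsNClique q s) :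
    edgesIn G T ≤ exClique T.card q := by
  have := (edgesIn_le_card_induce T).trans (card_edgeFinset_le_exClique
    ((G.cliqueFree_induce_iff _ _).mpr fun s hs => h s (by exact_mod_cast hs)))
  simpa using this

/-- A `K_q`-free graph on at least `q` vertices misses an edge, and adding one edge creates at most
a `K_q`, never a `K_{q+1}`. -/
theorem edgesIn_lt_exClique {T : Finset V} {q : ℕ} (hq : q ≤ T.card)
    (h : ∀ s ⊆ T, ¬ G.IsNClique q s) : edgesIn G T + 1 ≤ exClique T.card (q + 1) := by
  set H := G.induce (T : Set V) with hH
  have hfree : H.CliqueFree q := (G.cliqueFree_induce_iff _ _).mpr fun s hs => h s (by exact_mod_cast hs)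
  obtain ⟨a, b, hab, hne⟩ : ∃ a b, ¬ H.Adj a b ∧ a ≠ b := by
    by_contra hno
    push Not at hno
    obtain ⟨s, hs, hsq⟩ := Finset.exists_subset_card_eq (s := T) hq
    refine h s hs ⟨?_, hsq⟩
    intro x hx y hy hxy
    by_contra hxy'
    exact hxy (congrArg Subtype.val (hno ⟨x, hs hx⟩ ⟨y, hs hy⟩ hxy'))
  have h1 := card_edgeFinset_le_exClique (hfree.sup_edge a b)
  have h2 := SimpleGraph.card_edgeFinset_sup_edge H hab hne
  have h3 : edgesIn G T ≤ H.edgeFinset.card := by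
    convert edgesIn_le_card_induce T
  rw [h2] at h1
  simp only [Finset.coe_sort_coe, Fintype.card_coe] at h1
  omega

/-- Deleting the last vertex of the Turán graph on `2 * t + 1` vertices leaves the one on `2 * t`.
That vertex has degree at least `t`: `i ↦ i + 1` injects its non-neighbours into its neighbours,
consecutive numbers never being congruent modulo `r - 1 ≥ 2`. -/
theorem exClique_add_le {t r : ℕ} (hr : 3 ≤ r) :
    exClique (2 * t) r + t ≤ exClique (2 * t + 1) r := by
  obtain ⟨q, rfl⟩ : ∃ q, r = q + 1 := ⟨r - 1, by omega⟩
  have hnt : Nontrivial (Fin (q + 1)) := Fin.nontrivial_iff_two_le.mpr (by omega)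
  have key : ∀ n, exClique n (q + 1) = (SimpleGraph.turanGraph n q).edgeFinset.card := by
    intro n
    rw [exClique, SimpleGraph.extremalNumber_top]
    congr!
    simp
  rw [key, key, ← edgesIn_univ (G := SimpleGraph.turanGraph (2 * t + 1) q)]
  have hH : ∀ i j, (SimpleGraph.turanGraph (2 * t + 1) q).Adj i j ↔ i.1 % q ≠ j.1 % q :=
    fun i j => SimpleGraph.turanGraph_adj
  generalize SimpleGraph.turanGraph (2 * t + 1) q = H at hH
  rw [← Finset.insert_erase (Finset.mem_univ (Fin.last (2 * t))), edgesIn_insert (by simp)]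
  refine add_le_add ?_ ?_
  · refine edgesIn_le_of_hom (Fin.castSucc_injective _) (fun a => ?_) fun a b hab => ?_
    · simp [Fin.castSucc_ne_last]
    · simpa [hH, SimpleGraph.turanGraph_adj] using hab
  · set L := Finset.univ.erase (Fin.last (2 * t)) with hL
    have hcard : L.card = 2 * t := by simp [hL]
    have hsplit := Finset.card_filter_add_card_filter_not (s := L)
      (H.Adj (Fin.last (2 * t)))
    have hle : (L.filter fun i =>
        ¬ H.Adj (Fin.last (2 * t)) i).card ≤
        (L.filter (H.Adj (Fin.last (2 * t)))).card := by
      have hmod : ∀ i : Fin (2 * t + 1), i ∈ L →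
          ¬ H.Adj (Fin.last (2 * t)) i →
          i.1 + 1 < 2 * t ∧ (2 * t) % q = i.1 % q := by
        intro i hi hadj
        have hlt : i.1 < 2 * t := by
          have : i ≠ Fin.last (2 * t) := (Finset.mem_erase.mp hi).1
          have h2 : i.1 ≠ 2 * t := fun e => this (Fin.ext e)
          omega
        simp only [hH, Fin.val_last, not_not] at hadj
        refine ⟨?_, hadj⟩
        by_contra hge
        have e : i.1 + 1 = 2 * t := by omega
        have : (i.1 + 1) ≡ i.1 + 0 [MOD q] := by rw [e]; exact hadj
        have := Nat.ModEq.add_left_cancel' _ this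
        rw [Nat.modEq_zero_iff_dvd, Nat.dvd_one] at this
        omega
      refine Finset.card_le_card_of_injOn (fun i => i + 1) ?_ ?_
      · intro i hi
        obtain ⟨hiL, hadj⟩ := Finset.mem_filter.mp hi
        obtain ⟨h1, h2⟩ := hmod i hiL hadj
        have hv : (i + 1).1 = i.1 + 1 := Fin.val_add_one_of_lt (by
          rw [Fin.lt_def]; simp; omega)
        refine Finset.mem_coe.mpr (Finset.mem_filter.mpr ⟨Finset.mem_erase.mpr
          ⟨fun e => ?_, Finset.mem_univ _⟩, ?_⟩)
        · have := congrArg Fin.val e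
          simp only [hv, Fin.val_last] at this
          omega
        · rw [hH, hv, Fin.val_last]
          intro e
          have : (i.1 + 1) ≡ i.1 + 0 [MOD q] := e.symm.trans h2
          have := Nat.ModEq.add_left_cancel' _ this
          rw [Nat.modEq_zero_iff_dvd, Nat.dvd_one] at this
          omega
      · intro i _ j _ hij
        simpa using hij
    omega

variable {f : ℕ → V} {c : ℕ} {K : Finset V}

/-- The edges with an end outside a longest cycle. -/
theorem CycleOn.two_mul_edgesIn_le (hf : CycleOn G f c) (hm : CircumferenceLE G c)
    (hK : ∀ w, w ∈ K ↔ ∃ i < c, f i = w) (hG : IsTwoConnected G) {w : ℕ}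
    (hw : 2 * (c / 2) ≤ w + 1) (n : ℕ) : ∀ R : Finset V, R.card = n → (∀ x ∈ R, x ∉ K) →
    (∀ x ∈ R, 2 * (K.filter (G.Adj x)).card ≤ w) →
    2 * edgesIn G (K ∪ R) ≤ 2 * edgesIn G K + w * R.card := by
  induction n using Nat.strong_induction_on with
  | _ n ih =>
    intro R hn hR hdw
    rcases R.eq_empty_or_nonempty with rfl | hRn
    · simp
    have hstep : ∀ S ⊆ R, S ≠ R → 2 * edgesIn G (K ∪ S) ≤ 2 * edgesIn G K + w * S.card :=
      fun S hS hne => ih _ (hn ▸ Finset.card_lt_card (hS.ssubset_of_ne hne)) S rfl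
        (fun x hx => hR x (hS hx)) fun x hx => hdw x (hS hx)
    have hne : ∀ x ∈ R, ∀ S ⊆ R.erase x, S ≠ R := fun x hx S hS e =>
      (Finset.mem_erase.mp (hS (e.symm ▸ hx))).1 rfl
    by_cases h1 : ∃ x ∈ R, 2 * ((K.filter (G.Adj x)).card + (R.filter (G.Adj x)).card) ≤ w
    · obtain ⟨x, hx, hxd⟩ := h1
      have h2 := hstep _ (Finset.erase_subset x R) (hne x hx _ subset_rfl)
      rw [edgesIn_erase hR hx, ← Finset.card_erase_add_one hx, mul_add w]
      omega
    push Not at h1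
    -- Now every degree exceeds `w / 2`, hence is at least `c / 2`, and is not reached by neighbours
    -- in `K` alone. Removing the adjacent pair deletes `2 * (c / 2) - 1 ≤ w` edges.
    obtain ⟨x, hx, y, hy, hxy, hdx, hdy⟩ := hf.exists_adj_card_eq hm hK hG hR hRn
      (fun x hx => by have := h1 x hx; omega) (fun x hx => by
        by_contra hno
        push Not at hno
        have e : R.filter (G.Adj x) = ∅ := Finset.filter_eq_empty_iff.mpr fun y hy => hno y hy
        have h2 := h1 x hx
        rw [e, Finset.card_empty] at h2
        have := hdw x hx
        omega)
    have hyx : y ∈ R.erase x := Finset.mem_erase.mpr ⟨hxy.ne', hy⟩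
    have h2 := hstep ((R.erase x).erase y)
      ((Finset.erase_subset _ _).trans (Finset.erase_subset _ _))
      (hne x hx _ (Finset.erase_subset _ _))
    have e : (R.erase x).filter (G.Adj y) = (R.filter (G.Adj y)).erase x := by
      ext z; simp; tauto
    have hc : ((R.filter (G.Adj y)).erase x).card + 1 = (R.filter (G.Adj y)).card :=
      Finset.card_erase_add_one (Finset.mem_filter.mpr ⟨hx, hxy.symm⟩)
    rw [edgesIn_erase hR hx, edgesIn_erase (fun z hz => hR z (Finset.mem_of_mem_erase hz)) hyx, e,
      ← Finset.card_erase_add_one hx, ← Finset.card_erase_add_one hyx, mul_add w, mul_add w]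
    omega

end Edges

/-! ### Edges inside the cycle when an outer vertex has `t` neighbours on it. -/

section Core

open scoped Classical

variable {V : Type*} {G : SimpleGraph V}

/-- There is no slack: if `2 * s` were missing, at most `s` elements would fit below it and at most
`t - s - 1` above. -/
theorem two_mul_mem_of_spaced {T : Finset ℕ} {t : ℕ} (hT : ∀ i ∈ T, i < 2 * t - 1)
    (hsp : ∀ i ∈ T, ∀ j ∈ T, i < j → i + 2 ≤ j) (hcard : T.card = t) {s : ℕ} (hs : s < t) :
    2 * s ∈ T := by
  by_contra hno
  have h1 : 2 * (T.filter (· < 2 * s)).card ≤ 2 * s + 1 := by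
    rcases Nat.eq_zero_or_pos s with rfl | hpos
    · simp
    · have := card_le_of_spaced (T := T.filter (· < 2 * s)) (a := 0) (b := 2 * s - 1)
        (fun i hi => by have := (Finset.mem_filter.mp hi).2; omega)
        (fun i hi j hj => hsp i (Finset.mem_filter.mp hi).1 j (Finset.mem_filter.mp hj).1)
      omega
  have h2 : 2 * (T.filter (¬ · < 2 * s)).card ≤ 2 * (t - s) - 1 := by
    have hmem : ∀ i ∈ T.filter (¬ · < 2 * s), 2 * s + 1 ≤ i ∧ i ≤ 2 * t - 2 := fun i hi => by
      obtain ⟨h1, h2⟩ := Finset.mem_filter.mp hi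
      have h3 := hT i h1
      have h4 : i ≠ 2 * s := fun e => hno (e ▸ h1)
      omega
    have := card_le_of_spaced hmem
      (fun i hi j hj => hsp i (Finset.mem_filter.mp hi).1 j (Finset.mem_filter.mp hj).1)
    rcases (show s + 1 ≤ t from hs).lt_or_eq with h | h
    · omega
    · have : T.filter (¬ · < 2 * s) = ∅ := by
        rw [Finset.eq_empty_iff_forall_notMem]
        intro i hi
        have := hmem i hi
        omega
      rw [this, Finset.card_empty]
      omega
  have := Finset.card_filter_add_card_filter_not (s := T) (· < 2 * s)
  omega

variable {f : ℕ → V} {c : ℕ} {K : Finset V}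

theorem CycleOn.not_adj_consecutive (hf : CycleOn G f c) (hm : CircumferenceLE G c) {u : V}
    (hu : ∀ i, f i ≠ u) (i : ℕ) (h1 : G.Adj u (f i)) : ¬ G.Adj u (f (i + 1)) := by
  intro h2
  have h3 := hf.three_le
  have := (hf.shift i).gap hm (i := 0) (j := 1) (by omega) (by omega) (e := [u]) (by simp) (by simp)
    (by simp) (by simpa using fun j => hu (j + i)) (by simpa using h1.symm)
    (by simpa [add_comm 1 i] using h2.symm)
  simp at this

/-- If `u` has `t` neighbours on a longest cycle of length `2 t` or `2 t + 1`, then the cycle can be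
shifted so that its last one or two vertices are not neighbours of `u`. -/
theorem CycleOn.exists_shift (hf : CycleOn G f c) (hm : CircumferenceLE G c) {u : V}
    (hu : ∀ i, f i ≠ u) {t : ℕ} (hc : c = 2 * t ∨ c = 2 * t + 1) :
    ∃ k, ∀ i < c, G.Adj u (f (i + k)) → i < 2 * t - 1 := by
  have h3 := hf.three_le
  have hno := hf.not_adj_consecutive hm hu
  rcases hc with hc | hc
  · obtain ⟨j, hj⟩ : ∃ j, ¬ G.Adj u (f j) := by
      by_cases h : G.Adj u (f 0)
      · exact ⟨_, hno 0 h⟩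
      · exact ⟨0, h⟩
    refine ⟨j + 1, fun i hi h => ?_⟩
    by_contra hge
    rw [show i + (j + 1) = j + c by omega, hf.periodic] at h
    exact hj h
  · obtain ⟨j, hj, hj'⟩ : ∃ j, ¬ G.Adj u (f j) ∧ ¬ G.Adj u (f (j + 1)) := by
      by_contra hall
      push Not at hall
      -- Without two consecutive non-neighbours, adjacency to `u` would alternate around the cycle,
      -- which its odd length forbids.
      have key : ∀ n, G.Adj u (f (2 * n)) ↔ G.Adj u (f 0) := by
        intro n
        induction n with
        | zero => rfl
        | succ n ih =>
          rw [← ih]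
          constructor
          · intro h
            by_contra h'
            exact hno _ (hall _ h') h
          · intro h
            exact hall _ (hno _ h)
      have e : f (2 * t + 1) = f 0 := by rw [← hc, ← hf.periodic 0, zero_add]
      by_cases h : G.Adj u (f 0)
      · exact hno _ ((key t).mpr h) (e ▸ h)
      · exact h (e ▸ hall _ fun k => h ((key t).mp k))
    refine ⟨j + 2, fun i hi h => ?_⟩
    by_contra hge
    rcases (show i = 2 * t - 1 ∨ i = 2 * t by omega) with rfl | rfl
    · rw [show 2 * t - 1 + (j + 2) = j + c by omega, hf.periodic] at h
      exact hj h
    · rw [show 2 * t + (j + 2) = j + 1 + c by omega, hf.periodic] at h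
      exact hj' h

/-- The edges inside a longest cycle of length `2 t` or `2 t + 1` that has `t` neighbours of an
outer vertex. -/
theorem CycleOn.edgesIn_le [Fintype V] (hf : CycleOn G f c) (hm : CircumferenceLE G c)
    (hK : ∀ w, w ∈ K ↔ ∃ i < c, f i = w) {u : V} (huK : u ∉ K) {t r : ℕ}
    (hc : c = 2 * t ∨ c = 2 * t + 1) (hut : (K.filter (G.Adj u)).card = t) (hr : 3 ≤ r)
    (hrt : r ≤ t + 1) (hG : G.CliqueFree r) :
    edgesIn G K ≤ exClique t (r - 1) + t * (c - t) := by
  have hoff := hf.notMem_of_notMem hK huK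
  obtain ⟨k, hk⟩ := hf.exists_shift hm hoff hc
  have hg := hf.shift k
  have hKg : ∀ w, w ∈ K ↔ ∃ i < c, f (i + k) = w := fun w => by
    rw [hf.range_shift]; exact hK w
  have hgoff : ∀ i, f (i + k) ≠ u := fun i => hoff _
  generalize hgdef : (fun i => f (i + k)) = g at hg
  have hgk : ∀ i, f (i + k) = g i := fun i => by rw [← hgdef]
  simp only [hgk] at hk hKg hgoff
  clear hK hoff hgk hgdef hf
  have h3 := hg.three_le
  have hgK : ∀ i < c, g i ∈ K := fun i hi => (hKg _).mpr ⟨i, hi, rfl⟩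
  set A := K.filter (G.Adj u) with hA
  set T := (Finset.range c).filter fun i => G.Adj u (g i) with hT
  have hTmem : ∀ i, i ∈ T ↔ i < c ∧ G.Adj u (g i) := fun i => by simp [hT]
  have hTA : T.card = t := by
    rw [← hut]
    refine Finset.card_bij (fun i _ => g i) ?_ ?_ ?_
    · intro i hi
      exact Finset.mem_filter.mpr ⟨hgK i ((hTmem i).mp hi).1, ((hTmem i).mp hi).2⟩
    · intro i hi j hj
      exact hg.inj i ((hTmem i).mp hi).1 j ((hTmem j).mp hj).1
    · intro y hy
      obtain ⟨hy1, hy2⟩ := Finset.mem_filter.mp hy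
      obtain ⟨i, hi, rfl⟩ := (hKg y).mp hy1
      exact ⟨i, (hTmem i).mpr ⟨hi, hy2⟩, rfl⟩
  have hsp : ∀ i ∈ T, ∀ j ∈ T, i < j → i + 2 ≤ j := by
    intro i hi j hj hij
    by_contra hlt
    obtain rfl : j = i + 1 := by omega
    exact hg.not_adj_consecutive hm hgoff i ((hTmem i).mp hi).2 ((hTmem _).mp hj).2
  have heven : ∀ s < t, G.Adj u (g (2 * s)) := fun s hs =>
    ((hTmem _).mp (two_mul_mem_of_spaced
      (fun i hi => hk i ((hTmem i).mp hi).1 ((hTmem i).mp hi).2) hsp hTA hs)).2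
  have hodd : ∀ s < t, ¬ G.Adj u (g (2 * s + 1)) := fun s hs =>
    hg.not_adj_consecutive hm hgoff _ (heven s hs)
  set I := (Finset.range t).image fun s => g (2 * s + 1) with hI
  have hImem : ∀ x ∈ I, ∃ s < t, g (2 * s + 1) = x := fun x hx => by
    obtain ⟨s, hs, rfl⟩ := Finset.mem_image.mp hx
    exact ⟨s, Finset.mem_range.mp hs, rfl⟩
  have hIA : ∀ x ∈ I, x ∉ A := by
    intro x hx hxA
    obtain ⟨s, hs, rfl⟩ := hImem x hx
    exact hodd s hs (Finset.mem_filter.mp hxA).2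
  have hIcard : I.card = t := by
    rw [hI, Finset.card_image_of_injOn, Finset.card_range]
    intro i hi j hj hij
    simp only [Finset.coe_range, Set.mem_Iio] at hi hj
    have := hg.inj (2 * i + 1) (by omega) (2 * j + 1) (by omega) hij
    omega
  have hlt : ∀ i j, i < j → j < t → ¬ G.Adj (g (2 * i + 1)) (g (2 * j + 1)) := fun i j hij hj =>
    hg.not_adj_succ hm (show 2 * i < 2 * j by omega) (by omega) hgoff (heven i (by omega))
      (heven j hj)
  have hind : ∀ x ∈ I, ∀ y ∈ I, ¬ G.Adj x y := by
    intro x hx y hy hxy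
    obtain ⟨i, hi, rfl⟩ := hImem x hx
    obtain ⟨j, hj, rfl⟩ := hImem y hy
    rcases lt_trichotomy i j with h | rfl | h
    · exact hlt i j h hj hxy
    · exact G.loopless.irrefl _ hxy
    · exact hlt j i h hi hxy.symm
  have hcover : ∀ i < 2 * t, g i ∈ A ∪ I := by
    intro i hi
    rcases Nat.even_or_odd' i with ⟨s, rfl | rfl⟩
    · exact Finset.mem_union_left _
        (Finset.mem_filter.mpr ⟨hgK _ (by omega), heven s (by omega)⟩)
    · exact Finset.mem_union_right _
        (Finset.mem_image.mpr ⟨s, Finset.mem_range.mpr (by omega), rfl⟩)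
  have hAK : A ∪ I ⊆ K := Finset.union_subset (Finset.filter_subset _ _) fun x hx => by
    obtain ⟨s, hs, rfl⟩ := hImem x hx
    exact hgK _ (by omega)
  have hdegA : ∀ x, (A.filter (G.Adj x)).card ≤ t := fun x =>
    (Finset.card_filter_le _ _).trans hut.le
  -- All of `A` is joined to `u`, which would complete the clique to a `K_r`.
  have hcliqueA : ∀ s ⊆ A, ¬ G.IsNClique (r - 1) s := by
    intro s hs hcl
    have := hcl.insert (a := u) fun b hb => (Finset.mem_filter.mp (hs hb)).2
    rw [Nat.sub_add_cancel (by omega)] at this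
    exact hG _ this
  have hexA : edgesIn G A ≤ exClique t (r - 1) := by
    have := edgesIn_le_exClique hcliqueA
    rwa [hut] at this
  have hunion := edgesIn_union_of_independent hIA hind
  rcases hc with hc | hc
  · have hKe : K = A ∪ I := by
      refine Finset.Subset.antisymm (fun x hx => ?_) hAK
      obtain ⟨i, hi, rfl⟩ := (hKg x).mp hx
      exact hcover i (by omega)
    have hsum := Finset.sum_le_card_nsmul I (fun x => (A.filter (G.Adj x)).card) t
      fun x _ => hdegA x
    rw [hIcard, smul_eq_mul] at hsum
    rw [hKe, hunion, show c - t = t by omega]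
    omega
  · have hb'not : g (2 * t) ∉ A ∪ I := by
      intro h
      rcases Finset.mem_union.mp h with h | h
      · have := hk _ (by omega) (Finset.mem_filter.mp h).2
        omega
      · obtain ⟨s, hs, e⟩ := hImem _ h
        have := hg.inj _ (by omega) _ (by omega) e
        omega
    have hKe : K = insert (g (2 * t)) (A ∪ I) := by
      refine Finset.Subset.antisymm (fun x hx => ?_)
        (Finset.insert_subset (hgK _ (by omega)) hAK)
      obtain ⟨i, hi, rfl⟩ := (hKg x).mp hx
      rcases (show i < 2 * t ∨ i = 2 * t by omega) with h | rfl
      · exact Finset.mem_insert_of_mem (hcover i h)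
      · exact Finset.mem_insert_self _ _
    have hbI : g (2 * t - 1) ∈ I := Finset.mem_image.mpr
      ⟨t - 1, Finset.mem_range.mpr (by omega), by congr 1; omega⟩
    -- Vertices of `I` other than `g (2 * t - 1)` precede neighbours of `u`, as does `g (2 * t)`,
    -- which precedes `g 0`; so `CycleOn.not_adj_pred` applies.
    have hsub : I.filter (G.Adj (g (2 * t))) ⊆ {g (2 * t - 1)} := by
      intro x hx
      obtain ⟨hx, hadj⟩ := Finset.mem_filter.mp hx
      obtain ⟨s, hs, rfl⟩ := hImem x hx
      rw [Finset.mem_singleton]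
      by_contra hne
      have hst : s + 1 < t := by
        by_contra h
        exact hne (by congr 1; omega)
      have := hg.not_adj_pred hm (j := 2 * (s + 1)) (by omega) (by omega) hgoff
        (heven 0 (by omega)) (heven (s + 1) hst)
      rw [show 2 * (s + 1) - 1 = 2 * s + 1 by omega, show c - 1 = 2 * t by omega] at this
      exact this hadj.symm
    have hle1 : (I.filter (G.Adj (g (2 * t)))).card ≤ 1 := by
      simpa using Finset.card_le_card hsub
    have hsum := Finset.sum_le_card_nsmul (I.erase (g (2 * t - 1)))
      (fun x => (A.filter (G.Adj x)).card) t fun x _ => hdegA x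
    rw [Finset.card_erase_of_mem hbI, hIcard, smul_eq_mul] at hsum
    have hsum' := Finset.add_sum_erase I (fun x => (A.filter (G.Adj x)).card) hbI
    have hb := hdegA (g (2 * t - 1))
    have hb' := hdegA (g (2 * t))
    -- The naive bound exceeds this by one, coming from the edge between the last two vertices. If
    -- all terms are full, both are joined to the whole of `A`, so `A` is even `K_{r-2}`-free and
    -- `edgesIn_lt_exClique` saves the edge.
    have key : edgesIn G A + (A.filter (G.Adj (g (2 * t - 1)))).card +
        (A.filter (G.Adj (g (2 * t)))).card + (I.filter (G.Adj (g (2 * t)))).card ≤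
        exClique t (r - 1) + 2 * t := by
      by_cases hfull : (A.filter (G.Adj (g (2 * t - 1)))).card = t ∧
          (A.filter (G.Adj (g (2 * t)))).card = t ∧ (I.filter (G.Adj (g (2 * t)))).card = 1
      · obtain ⟨f1, f2, f3⟩ := hfull
        have a1 : ∀ x ∈ A, G.Adj (g (2 * t - 1)) x := fun x hx => by
          have := Finset.eq_of_subset_of_card_le (Finset.filter_subset (G.Adj (g (2 * t - 1))) A)
            (by rw [f1]; exact hut.le)
          exact (Finset.mem_filter.mp (this.symm ▸ hx)).2
        have a2 : ∀ x ∈ A, G.Adj (g (2 * t)) x := fun x hx => by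
          have := Finset.eq_of_subset_of_card_le (Finset.filter_subset (G.Adj (g (2 * t))) A)
            (by rw [f2]; exact hut.le)
          exact (Finset.mem_filter.mp (this.symm ▸ hx)).2
        have a3 : G.Adj (g (2 * t)) (g (2 * t - 1)) := by
          have := Finset.eq_of_subset_of_card_le hsub (by rw [f3]; simp)
          exact (Finset.mem_filter.mp (this.symm ▸ Finset.mem_singleton_self _)).2
        have hfree : ∀ s ⊆ A, ¬ G.IsNClique (r - 2) s := by
          intro s hs hcl
          have h1 := hcl.insert (a := g (2 * t - 1)) fun b hb => a1 b (hs hb)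
          have h2 := h1.insert (a := g (2 * t)) fun b hb => by
            rcases Finset.mem_insert.mp hb with rfl | hb
            · exact a3
            · exact a2 b (hs hb)
          rw [show r - 2 + 1 + 1 = r by omega] at h2
          exact hG _ h2
        have := edgesIn_lt_exClique (by omega) hfree
        rw [hut, show r - 2 + 1 = r - 1 by omega] at this
        omega
      · omega
    rw [hKe, edgesIn_insert hb'not, hunion, card_filter_union_of_disjoint hIA,
      show c - t = t - 1 + 2 by omega, mul_add t, mul_comm t (t - 1)]
    omega

end Core

end CliqueCircumference

/-! ### The main theorem: choice of `w` and of the bound inside the cycle. -/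

open CliqueCircumference in
theorem mainTheorem6 {V : Type*} [Fintype V] (G : SimpleGraph V) [Fintype G.edgeSet]
    (n k r t : ℕ) (hk : 5 ≤ k) (hkn : k ≤ n) (ht : t = (k - 1) / 2) (hr : r ≤ t + 1)
    (hV : Fintype.card V = n) (hG : IsTwoConnected G) (hKr : G.CliqueFree r)
    (hCk : LongCycleFree G k) {v : V} (C : G.Walk v v) (hC : IsLongestCycle C) :
    ((C.length = k - 1 ∧ ∃ u : V, u ∉ C.support ∧ degOn C u = t) →
      (G.edgeFinset.card : ℝ) ≤ exClique t (r - 1) + (t : ℝ) * ((n : ℝ) - t)) ∧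
    ((Even k ∧ C.length = k - 2 ∧ ∃ u : V, u ∉ C.support ∧ degOn C u = t) →
      (G.edgeFinset.card : ℝ) ≤ exClique t (r - 1) + (t : ℝ) * ((n : ℝ) - t)) ∧
    (¬ (C.length = k - 1 ∧ ∃ u : V, u ∉ C.support ∧ degOn C u = t) →
      ¬ (Even k ∧ C.length = k - 2 ∧ ∃ u : V, u ∉ C.support ∧ degOn C u = t) →
      (G.edgeFinset.card : ℝ) ≤
        max (((t : ℝ) - 1 / 2) * ((n : ℝ) - 1))
          (exClique (k - 1) r + ((t : ℝ) - 1 / 2) * ((n : ℝ) - k + 1))) := by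
  classical
  have hlt := hCk v C hC.1
  have hm := circumferenceLE_of_isCycle hC.1.three_le_length hC.2
  obtain ⟨f, hf, hfC⟩ := cycleOn_of_isCycle hC.1
  generalize hc : C.length = c at *
  have h3 := hf.three_le
  set K : Finset V := Finset.univ.filter (· ∈ C.support) with hKdef
  have hKC : ∀ w, w ∈ K ↔ w ∈ C.support := fun w => by simp [hKdef]
  have hK : ∀ w, w ∈ K ↔ ∃ i < c, f i = w := fun w => (hKC w).trans (hfC w)
  have hdeg : ∀ u, degOn C u = (K.filter (G.Adj u)).card := by
    intro u
    rw [degOn, ← Set.ncard_coe_finset]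
    congr 1
    ext w
    simp [hKC]
  have hKcard : K.card = c := by
    have : K = (Finset.range c).image f := by
      ext w
      simp [hK]
    rw [this, Finset.card_image_of_injOn, Finset.card_range]
    intro i hi j hj
    exact hf.inj i (by simpa using hi) j (by simpa using hj)
  set R := Finset.univ \ K with hRdef
  have hR : ∀ x ∈ R, x ∉ K := fun x hx => (Finset.mem_sdiff.mp hx).2
  have hKR : K ∪ R = Finset.univ := Finset.union_sdiff_of_subset (Finset.subset_univ K)
  have hRcard : R.card + c = n := by
    rw [← hV, ← Finset.card_univ, ← hKR, Finset.card_union_of_disjoint Finset.disjoint_sdiff, hKcard,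
      add_comm]
  have hr3 : 3 ≤ r := by
    by_contra h
    have hadj := hf.adj 0
    rw [SimpleGraph.cliqueFree_two.mp (hKr.mono (show r ≤ 2 by omega))] at hadj
    exact hadj
  have htwo : ∀ x ∉ K, 2 * (K.filter (G.Adj x)).card ≤ c := fun x hx => hf.two_mul_card_le hm hK hx
  have htotal : ∀ w, 2 * (c / 2) ≤ w + 1 → (∀ x ∉ K, 2 * (K.filter (G.Adj x)).card ≤ w) →
      2 * G.edgeFinset.card ≤ 2 * edgesIn G K + w * R.card := by
    intro w hw hdw
    have := hf.two_mul_edgesIn_le hm hK hG hw _ R rfl hR fun x hx => hdw x (hR x hx)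
    rwa [hKR, edgesIn_univ] at this
  have hdense : ∀ u, u ∉ C.support → degOn C u = t → (c = 2 * t ∨ c = 2 * t + 1) →
      (G.edgeFinset.card : ℝ) ≤ exClique t (r - 1) + (t : ℝ) * ((n : ℝ) - t) := by
    intro u hu hut hct
    have huK : u ∉ K := fun h => hu ((hKC u).mp h)
    have h1 := hf.edgesIn_le hm hK huK hct ((hdeg u).symm.trans hut) hr3 hr hKr
    have h2 := htotal (2 * t) (by omega) fun x hx => by have := htwo x hx; omega
    have h4 : G.edgeFinset.card ≤ exClique t (r - 1) + t * (c - t) + t * R.card := by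
      rw [mul_assoc] at h2
      omega
    have h5 : t * (c - t) + t * R.card = t * (n - t) := by
      rw [← mul_add]
      congr 1
      omega
    rw [add_assoc, h5] at h4
    have h6 : ((n - t : ℕ) : ℝ) = (n : ℝ) - t := Nat.cast_sub (by omega)
    rw [← h6]
    exact_mod_cast h4
  -- no vertex off the cycle has `t` neighbours on it
  have hsparse : (∀ u, u ∉ C.support → degOn C u ≠ t) → (c = 2 * t ∨ c = 2 * t + 1) →
      2 * G.edgeFinset.card ≤ 2 * exClique c r + (2 * t - 1) * R.card := by
    intro hno hct
    have h1 := htotal (2 * t - 1) (by omega) fun x hx => by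
      have h2 := htwo x hx
      have h4 := hno x fun h => hx ((hKC x).mpr h)
      rw [hdeg] at h4
      omega
    have h2 := edgesIn_le_exClique (G := G) (T := K) (q := r) fun s _ => hKr s
    rw [hKcard] at h2
    omega
  refine ⟨?_, ?_, ?_⟩
  · rintro ⟨h1, u, hu, hut⟩
    exact hdense u hu hut (by omega)
  · rintro ⟨⟨k', hk'⟩, h1, u, hu, hut⟩
    exact hdense u hu hut (by omega)
  · intro hn1 hn2
    have hkn' : (n : ℝ) - k + 1 = ((n - k + 1 : ℕ) : ℝ) := by
      push_cast [Nat.cast_sub hkn]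
      ring
    have hfin : 2 * G.edgeFinset.card ≤ 2 * exClique (k - 1) r + (2 * t - 1) * (n - k + 1) →
        (G.edgeFinset.card : ℝ) ≤
          exClique (k - 1) r + ((t : ℝ) - 1 / 2) * ((n : ℝ) - k + 1) := by
      intro h
      have h' : (2 * G.edgeFinset.card : ℝ) ≤
          2 * exClique (k - 1) r + (2 * t - 1) * ((n - k + 1 : ℕ) : ℝ) := by
        have : ((2 * t - 1 : ℕ) : ℝ) = 2 * t - 1 := by
          rw [Nat.cast_sub (by omega)]; push_cast; ring
        rw [← this]
        exact_mod_cast h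
      rw [hkn']
      linarith
    -- For odd `k` one has `k - 1 = 2 * t`, so `c ≤ k - 2` already means `c ≤ 2 * t - 1`; only for
    -- even `k` is `c = k - 2 = 2 * t` a separate case.
    rcases (show c = k - 1 ∨ c = k - 2 ∧ k = 2 * t + 2 ∨ c ≤ 2 * t - 1 by omega) with
      h | ⟨h, hk2⟩ | h
    · refine le_max_of_le_right (hfin ?_)
      have := hsparse (fun u hu hut => hn1 ⟨h, u, hu, hut⟩) (by omega)
      rwa [h, show R.card = n - k + 1 by omega] at this
    · refine le_max_of_le_right (hfin ?_)
      have h1 := hsparse (fun u hu hut => hn2 ⟨⟨t + 1, by omega⟩, h, u, hu, hut⟩) (by omega)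
      -- There is one outer vertex more than `n - k + 1`; its cost `t - 1/2` is covered by the
      -- growth of the Turán number from `2 * t` to `2 * t + 1` vertices.
      have h2 := exClique_add_le (t := t) hr3
      rw [show c = 2 * t by omega, show R.card = n - k + 1 + 1 by omega, mul_add, mul_one] at h1
      rw [show k - 1 = 2 * t + 1 by omega]
      omega
    · refine le_max_of_le_left ?_
      have h1 := htotal c (by omega) htwo
      have h2 := two_mul_edgesIn_le (G := G) K
      rw [hKcard] at h2
      -- The pairs in `K` give `c * (c - 1)` and the outer vertices `c * (n - c)`.
      have h4 : 2 * G.edgeFinset.card ≤ c * (n - 1) := by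
        have : c * (n - 1) = c * (c - 1) + c * R.card := by
          rw [← mul_add]
          congr 1
          omega
        omega
      have h5 : 2 * G.edgeFinset.card ≤ (2 * t - 1) * (n - 1) :=
        h4.trans (Nat.mul_le_mul_right _ h)
      have h6 : (2 * G.edgeFinset.card : ℝ) ≤ (2 * t - 1) * ((n : ℝ) - 1) := by
        have e1 : ((2 * t - 1 : ℕ) : ℝ) = 2 * t - 1 := by
          rw [Nat.cast_sub (by omega)]; push_cast; ring
        have e2 : ((n - 1 : ℕ) : ℝ) = (n : ℝ) - 1 := by
          rw [Nat.cast_sub (by omega)]; push_cast; ring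
        rw [← e1, ← e2]
        exact_mod_cast h5
      linarith
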